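/- **Setting.** Let $(\theta_i)_{i\ge 1}$ and, for each sample size $T\ge 1$, $(\varepsilon_{i,T})_{i\ge1}$ be real random variables such that for each $T$ the pairs $(\theta_i,\varepsilon_{i,T})$ are independent and identically distributed over $i$ (the dependence between $\theta_i$ and $\varepsilon_{i,T}$ is unrestricted). Let $F$ be the cdf of $\theta_i$ and $G_T$ the cdf of $\varepsilon_{i,T}$, and let $\{G_T\}_{T\ge1}$ be tight. For a cdf $H$ write $H^{-1}(q)=\inf\{x\in\mathbb R: H(x)\ge q\}\in[-\infty,\infty]$. Let $p>0$, $\delta\in(0,1)$, and let $k=k(N)$ be integers with $k=N^\delta$ up to rounding (it is enough that $k/N^\delta\to1$). Put $$c_N=\frac Nk\,\Big[\Big(\frac1{1-F}\Big)^{-1}\Big]'\Big(\frac Nk\Big),$$ where $(1/(1-F))^{-1}$ is the left-continuous generalized inverse of $1/(1-F)$. Let $U_1,U_2,\dots$ be iid Uniform$[0,1]$ and let $U_{k,N}$ be the $k$-th smallest of $U_1,\dots,U_N$. All limits in $(N,T)$ are along an arbitrary joint limit in which $N\to\infty$ and $T\to\infty$ (for instance any sequence of pairs $(N_j,T_j)$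 with both coordinates tending to infinity). **Proposition.** Let $\gamma'<\gamma$ be real numbers and suppose that one of the following holds as $N,T\to\infty$: 1. for some $\beta>0$, $\sup_T \mathbb E|\varepsilon_{i,T}|^\beta<\infty$, and for some $\nu>0$ $$\frac{N^{\frac\delta2\left(1+\frac1\beta\right)+(1-\delta)\left(-\gamma'+\frac1\beta\right)+\frac\nu\beta}}{T^p}\to0;$$ 2. for every $T$, $\varepsilon_{i,T}\sim N(\mu_T,\sigma_T^2)$ for some $\mu_T\in\mathbb R$, $\sigma_T^2\ge0$, and $$\frac{N^{\frac\delta2+(1-\delta)(-\gamma')}\sqrt{\log N}}{T^p}\to0.$$ Suppose also that $F$ satisfies the first order von Mises condition with extreme value index $\gamma$: in some left neighbourhood of the right endpoint $F^{-1}(1)\in(-\infty,\infty]$ the cdf $F$ is twice differentiable with positive derivative $f$, $F$ has no jump at $F^{-1}(1)$, and $\lim_{t\uparrow F^{-1}(1)}\big(\frac{1-F}{f}\big)'(t)=\gamma$. Then, as $N,T\to\infty$, the intermediate tail equivalence conditions hold: for some $\epsilon\in(0,1)$ $$\sup_{u\in[0,\epsilon]}\frac{\sqrt k}{c_N}\Big(F^{-1}(1-U_{k,N}-u)-F^{-1}(1-U_{k,N})+\frac1{T^p}G_T^{-1}(u)\Big)\xrightarrow{p}0,$$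 and $$\inf_{u\in[0,U_{k,N}]}\frac{\sqrt k}{c_N}\Big(F^{-1}(1-U_{k,N}+u)-F^{-1}(1-U_{k,N})+\frac1{T^p}G_T^{-1}(1-u)\Big)\xrightarrow{p}0.$$ -/

import Mathlib

open MeasureTheory ProbabilityTheory Filter Topology Set
open scoped ENNReal NNReal

noncomputable section

namespace NoisyEVT

/-- The (left-continuous) generalized inverse `y ↦ inf {x ∈ ℝ : g x ≥ y}` of a nondecreasing
extended-real-valued function `g` on `ℝ`. The infimum is taken in `[-∞, ∞]`. -/
def genInv (g : ℝ → EReal) (y : EReal) : EReal :=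
  ⨅ (x : ℝ) (_ : y ≤ g x), (x : EReal)

/-- The quantile function `F⁻¹(q) = inf {x ∈ ℝ : F x ≥ q}` of a law `μ` on `ℝ` with cdf `F`.
It takes values in `[-∞, ∞]`; `quantile μ 1` is the right endpoint of `F`, finite or infinite. -/
def quantile (μ : Measure ℝ) (q : ℝ) : EReal :=
  genInv (fun x => ((cdf μ x : ℝ) : EReal)) (q : EReal)

/-- The function `(1 / (1 - F))⁻¹`, i.e. the inverse of `x ↦ 1 / (1 - F x)`, where
`1 / (1 - F x) = ∞` if `F x = 1`. It is finite at every `t > 1`. -/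
def tailQuantile (μ : Measure ℝ) (t : ℝ) : ℝ :=
  (genInv (fun x => (((ENNReal.ofReal (1 - cdf μ x))⁻¹ : ℝ≥0∞) : EReal)) (t : EReal)).toReal

/-- `c_N = (N / k) * ((1 / (1 - F))⁻¹)'(N / k)`. -/
def scale (μ : Measure ℝ) (N k : ℕ) : ℝ :=
  ((N : ℝ) / k) * deriv (tailQuantile μ) ((N : ℝ) / k)

/-- The filter `t ↑ F⁻¹(1)` of left neighbourhoods (in `ℝ`) of the right endpoint. -/
def leftOfEndpoint (μ : Measure ℝ) : Filter ℝ :=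
  comap ((↑) : ℝ → EReal) (𝓝[<] (quantile μ 1))

/-- First order von Mises condition with extreme value index `γ`: in some left neighbourhood of
the right endpoint `F` is twice differentiable with positive derivative `f`, `F` does not jump at
the right endpoint (automatic if the law has a Lebesgue density), and
`((1 - F) / f)'(t) → γ` as `t ↑ F⁻¹(1)`. -/
structure VonMises (μ : Measure ℝ) (γ : ℝ) : Prop where
  twice_differentiable : ∀ᶠ t in leftOfEndpoint μ,
    DifferentiableAt ℝ (cdf μ) t ∧ DifferentiableAt ℝ (deriv (cdf μ)) t
  density_pos : ∀ᶠ t in leftOfEndpoint μ, 0 < deriv (cdf μ) t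
  no_atom : Tendsto (cdf μ) (leftOfEndpoint μ) (𝓝 1)
  tendsto_index :
    Tendsto (deriv (fun t => (1 - cdf μ t) / deriv (cdf μ) t)) (leftOfEndpoint μ) (𝓝 γ)

/-- The `k`-th smallest among `x 0, …, x (N - 1)` (for `1 ≤ k ≤ N`): the least `t` such that at
least `k` of these numbers are `≤ t`. -/
def orderStat (N k : ℕ) (x : ℕ → ℝ) : ℝ :=
  sInf {t : ℝ | k ≤ ((Finset.range N).filter (fun i => x i ≤ t)).card}

/-- Convergence in probability to `0` of extended-real-valued random quantities. -/
def TendstoInProbZero {α Ω : Type*} [MeasurableSpace Ω] (P : Measure Ω)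
    (X : α → Ω → EReal) (L : Filter α) : Prop :=
  ∀ η : ℝ, 0 < η → Tendsto (fun a => P {ω | ENNReal.ofReal η ≤ (X a ω).abs}) L (𝓝 0)

/-- The quantity in the supremum tail equivalence condition, for `U_{k,N} = v`:
`sup_{u ∈ [0, ε]} (√k / c_N) (F⁻¹(1 - v - u) - F⁻¹(1 - v) + T^{-p} G⁻¹(u))`. -/
def teSup (F G : Measure ℝ) (p ε : ℝ) (N k T : ℕ) (v : ℝ) : EReal :=
  ⨆ u ∈ Icc (0 : ℝ) ε, ((√(k : ℝ) / scale F N k : ℝ) : EReal) *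
    (quantile F (1 - v - u) - quantile F (1 - v)
      + ((1 / (T : ℝ) ^ p : ℝ) : EReal) * quantile G u)

/-- The quantity in the infimum tail equivalence condition, for `U_{k,N} = v`:
`inf_{u ∈ [0, v]} (√k / c_N) (F⁻¹(1 - v + u) - F⁻¹(1 - v) + T^{-p} G⁻¹(1 - u))`. -/
def teInf (F G : Measure ℝ) (p : ℝ) (N k T : ℕ) (v : ℝ) : EReal :=
  ⨅ u ∈ Icc (0 : ℝ) v, ((√(k : ℝ) / scale F N k : ℝ) : EReal) *
    (quantile F (1 - v + u) - quantile F (1 - v)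
      + ((1 / (T : ℝ) ^ p : ℝ) : EReal) * quantile G (1 - u))

/-- The intermediate supremum tail equivalence condition, as `(N, T) → ∞` along `L`: for some
`ε ∈ (0, 1)` the supremum over `[0, ε]` converges to `0` in probability, `U` being the sequence of
iid uniform variables whose order statistics `U_{k,N}` enter the condition. -/
def IntermediateTESup {Ω : Type*} [MeasurableSpace Ω] (P : Measure Ω) (U : ℕ → Ω → ℝ)
    (F : Measure ℝ) (G : ℕ → Measure ℝ) (p : ℝ) (k : ℕ → ℕ) (L : Filter (ℕ × ℕ)) : Prop :=
  ∃ ε ∈ Ioo (0 : ℝ) 1, TendstoInProbZero P (fun (a : ℕ × ℕ) ω =>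
    teSup F (G a.2) p ε a.1 (k a.1) a.2 (orderStat a.1 (k a.1) (fun i => U i ω))) L

/-- The intermediate infimum tail equivalence condition, as `(N, T) → ∞` along `L`. -/
def IntermediateTEInf {Ω : Type*} [MeasurableSpace Ω] (P : Measure Ω) (U : ℕ → Ω → ℝ)
    (F : Measure ℝ) (G : ℕ → Measure ℝ) (p : ℝ) (k : ℕ → ℕ) (L : Filter (ℕ × ℕ)) : Prop :=
  TendstoInProbZero P (fun (a : ℕ × ℕ) ω =>
    teInf F (G a.2) p a.1 (k a.1) a.2 (orderStat a.1 (k a.1) (fun i => U i ω))) L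

end NoisyEVT

end

namespace NoisyEVT

/-! Put `A x = F⁻¹(1 - e⁻ˣ)` and `g = (1 - F) / f`. Near infinity `A' = g ∘ A` and `(log A')' = g' ∘
A → γ`. Hence `c = A'`, which at `x = log (N / k)` is the normalization `c_N`, eventually exceeds
`exp (γ' x)` (`eventually_exp_mul_le`) and changes only by bounded factors over windows of bounded
length, so that `F⁻¹(1 - w)` is Lipschitz with constant of order `c_N N / k` for `w` of order `k /
N` (`VonMises.exists_abs_quantile_sub_le`).

By Chebyshev, `v = U_{k,N}` lies in `[k / (2N), 2k / N]` with high probability, and the rest is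
deterministic (`eventually_te_abs_le`). Let `r = √k / (c_N T^p)`. In the supremum the increment of
`F⁻¹` is nonpositive, and tightness bounds `G_T⁻¹` above by some `M` on `[0, 1/2]`, so the supremum
is at most `r M`. For a lower bound a single point suffices: at `u = η √k / N` the increment of
`F⁻¹` costs at most `C η` after scaling, and the noise costs `r b`, where `b` bounds `|ε|` up to
probability less than `u`. Markov's inequality or Gaussian concentration supplies `b`, and the rate
conditions are what makes `r b → 0` (`relNoise_bound_moment`, `relNoise_bound_gaussian`). As `b ≥
1`, this also gives `r M → 0`. The infimum is the mirror image. -/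

/-! ### Quantile functions. -/

lemma genInv_mono (g : ℝ → EReal) : Monotone (genInv g) := fun _ _ h =>
  iInf_mono fun _ => iInf_mono' fun hx => ⟨h.trans hx, le_rfl⟩

lemma quantile_mono (μ : Measure ℝ) : Monotone (quantile μ) := fun _ _ h =>
  genInv_mono _ (EReal.coe_le_coe_iff.2 h)

lemma quantile_le_of_le_cdf {μ : Measure ℝ} {q x : ℝ} (h : q ≤ cdf μ x) :
    quantile μ q ≤ x :=
  iInf₂_le x (EReal.coe_le_coe_iff.2 h)

lemma le_quantile {μ : Measure ℝ} {q x : ℝ} (h : ∀ y < x, cdf μ y < q) :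
    (x : EReal) ≤ quantile μ q :=
  le_iInf₂ fun y hy => by
    by_contra! hlt
    exact absurd (EReal.coe_le_coe_iff.1 hy) (not_le.2 (h y (EReal.coe_lt_coe_iff.1 hlt)))

lemma lt_one_of_coe_lt_quantile_one {μ : Measure ℝ} {x : ℝ} (h : (x : EReal) < quantile μ 1) :
    cdf μ x < 1 := by
  by_contra! h1
  exact absurd (quantile_le_of_le_cdf h1) (not_le.2 h)

lemma neg_le_quantile_of_measure_abs_lt {μ : Measure ℝ} [IsProbabilityMeasure μ] {b u : ℝ}
    (h : μ.real {x | b < |x|} < u) : ((-b : ℝ) : EReal) ≤ quantile μ u := by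
  refine le_quantile fun y hy => ?_
  rw [cdf_eq_real]
  refine (measureReal_mono fun z hz => ?_).trans_lt h
  have : z ≤ y := hz
  show b < |z|
  exact lt_abs.2 (Or.inr (by linarith))

lemma quantile_one_sub_le_of_measure_abs_lt {μ : Measure ℝ} [IsProbabilityMeasure μ] {b u : ℝ}
    (h : μ.real {x | b < |x|} < u) : quantile μ (1 - u) ≤ b := by
  refine quantile_le_of_le_cdf ?_
  rw [cdf_eq_real]
  have h1 : μ.real (Iic b)ᶜ ≤ μ.real {x | b < |x|} :=
    measureReal_mono fun z (hz : ¬ z ≤ b) => lt_abs.2 (Or.inl (not_le.1 hz))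
  have h2 := probReal_compl_eq_one_sub (μ := μ) (measurableSet_Iic (a := b))
  linarith

/-- The conditions `1 / (1 - F x) ≥ t` and `F x ≥ 1 - 1 / t` define the same set; the `ℝ≥0∞` inverse
covers `F x = 1`. -/
lemma tailQuantile_eq_toReal_quantile (μ : Measure ℝ) {t : ℝ} (ht : 0 < t) :
    tailQuantile μ t = (quantile μ (1 - 1 / t)).toReal := by
  unfold tailQuantile quantile genInv
  congr 1
  refine iInf_congr fun x => iInf_congr_Prop ?_ fun _ => rfl
  have h1 : (t : EReal) = ((ENNReal.ofReal t : ℝ≥0∞) : EReal) := by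
    rw [EReal.coe_ennreal_ofReal, max_eq_left ht.le]
  rw [h1, EReal.coe_ennreal_le_coe_ennreal_iff, ENNReal.le_inv_iff_le_inv,
    ← ENNReal.ofReal_inv_of_pos ht, ENNReal.ofReal_le_ofReal_iff (inv_nonneg.2 ht.le),
    EReal.coe_le_coe_iff, one_div]
  constructor <;> intro h <;> linarith

lemma abs_le_ofReal {X : EReal} {q : ℝ} (h1 : ((-q : ℝ) : EReal) ≤ X) (h2 : X ≤ (q : EReal)) :
    X.abs ≤ ENNReal.ofReal q := by
  induction X with
  | bot => exact absurd h1 (not_le.2 (EReal.bot_lt_coe _))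
  | top => exact absurd h2 (not_le.2 (EReal.coe_lt_top _))
  | coe x =>
    rw [EReal.abs_def]
    exact ENNReal.ofReal_le_ofReal
      (abs_le.2 ⟨EReal.coe_le_coe_iff.1 h1, EReal.coe_le_coe_iff.1 h2⟩)

/-! ### The von Mises condition in logarithmic coordinates. -/

lemma exists_real_of_eventually_leftOfEndpoint {μ : Measure ℝ} {Q : ℝ → Prop}
    (hbot : ⊥ < quantile μ 1) (h : ∀ᶠ t in leftOfEndpoint μ, Q t) :
    ∃ a : ℝ, (a : EReal) < quantile μ 1 ∧ ∀ t : ℝ, a < t → (t : EReal) < quantile μ 1 → Q t := by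
  obtain ⟨b, hb, hQ⟩ :=
    ((nhdsLT_basis_of_exists_lt ⟨⊥, hbot⟩).comap ((↑) : ℝ → EReal)).eventually_iff.1 h
  obtain ⟨a, hba, ha⟩ := EReal.lt_iff_exists_real_btwn.1 hb
  exact ⟨a, ha, fun t h1 h2 => hQ ⟨hba.trans (EReal.coe_lt_coe_iff.2 h1), h2⟩⟩

lemma tendsto_leftOfEndpoint {α : Type*} {l : Filter α} {μ : Measure ℝ} {A : α → ℝ}
    (hbot : ⊥ < quantile μ 1) (hlt : ∀ᶠ x in l, (A x : EReal) < quantile μ 1)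
    (hgt : ∀ a : ℝ, (a : EReal) < quantile μ 1 → ∀ᶠ x in l, a < A x) :
    Tendsto A l (leftOfEndpoint μ) := by
  rw [leftOfEndpoint, tendsto_comap_iff,
    (nhdsLT_basis_of_exists_lt ⟨⊥, hbot⟩).tendsto_right_iff]
  intro b hb
  obtain ⟨a, hba, ha⟩ := EReal.lt_iff_exists_real_btwn.1 hb
  filter_upwards [hlt, hgt a ha] with x h1 h2
  exact ⟨hba.trans (EReal.coe_lt_coe_iff.2 h2), h1⟩

lemma bot_lt_quantile_one (μ : Measure ℝ) : ⊥ < quantile μ 1 := by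
  obtain ⟨a, ha⟩ := ((tendsto_cdf_atBot μ).eventually_lt_const zero_lt_one).exists
  exact (EReal.bot_lt_coe a).trans_le
    (le_quantile fun y hy => (monotone_cdf μ hy.le).trans_lt ha)

/-- Under the von Mises condition the logarithmic tail quantile function `A x = F⁻¹(1 - e⁻ˣ)` is
differentiable near infinity, its derivative is the scale `c`, and `(log c)' → γ`. -/
lemma VonMises.exists_logTailQuantile {μ : Measure ℝ} {γ : ℝ} (h : VonMises μ γ) :
    ∃ A c d : ℝ → ℝ, Tendsto d atTop (𝓝 γ) ∧ ∀ᶠ x in atTop,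
      quantile μ (1 - Real.exp (-x)) = A x ∧ HasDerivAt A (c x) x ∧ 0 < c x ∧
      HasDerivAt (fun y => Real.log (c y)) (d x) x ∧
      Real.exp x * deriv (tailQuantile μ) (Real.exp x) = c x := by
  have hbot := bot_lt_quantile_one μ
  obtain ⟨a, ha, hD⟩ := exists_real_of_eventually_leftOfEndpoint hbot
    (h.twice_differentiable.and h.density_pos)
  set F : ℝ → ℝ := ⇑(cdf μ) with hFdef
  set D : Set ℝ := Ioi a ∩ ((↑) : ℝ → EReal) ⁻¹' Iio (quantile μ 1) with hDdef
  have hDopen : IsOpen D := isOpen_Ioi.inter (isOpen_Iio.preimage continuous_coe_real_ereal)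
  have hDconn : D.OrdConnected := ⟨fun s hs t ht r hr =>
    ⟨lt_of_lt_of_le hs.1 hr.1, lt_of_le_of_lt (EReal.coe_le_coe_iff.2 hr.2) ht.2⟩⟩
  have hdiff : ∀ t ∈ D, DifferentiableAt ℝ F t := fun t ht => (hD t ht.1 ht.2).1.1
  have hdiff2 : ∀ t ∈ D, DifferentiableAt ℝ (deriv F) t := fun t ht => (hD t ht.1 ht.2).1.2
  have hpos : ∀ t ∈ D, 0 < deriv F t := fun t ht => (hD t ht.1 ht.2).2
  have hlt1 : ∀ t ∈ D, F t < 1 := fun t ht => lt_one_of_coe_lt_quantile_one ht.2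
  have hcont : ContinuousOn F D := fun t ht => (hdiff t ht).continuousAt.continuousWithinAt
  have hmono : StrictMonoOn F D := strictMonoOn_of_deriv_pos hDconn.convex hcont
    fun t ht => hpos t (interior_subset ht)
  have hFm : Monotone F := monotone_cdf μ
  -- Strict monotonicity on `D` excludes a flat piece of `F` to the left of `t`; a point between
  -- `max y a` and `t` also handles `y` outside `D`.
  have hquant : ∀ t ∈ D, quantile μ (F t) = t := fun t ht => by
    refine le_antisymm (quantile_le_of_le_cdf le_rfl) (le_quantile fun y hy => ?_)
    obtain ⟨s, hs1, hs2⟩ := exists_between (max_lt hy ht.1)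
    exact (hFm ((le_max_left y a).trans hs1.le)).trans_lt
      (hmono ⟨(le_max_right y a).trans_lt hs1, (EReal.coe_lt_coe_iff.2 hs2).trans ht.2⟩ ht hs2)
  have hpick : ∀ b : ℝ, (b : EReal) < quantile μ 1 → ∃ t ∈ D, b < t := fun b hb => by
    obtain ⟨t, ht1, ht2⟩ := EReal.lt_iff_exists_real_btwn.1 (max_lt ha hb)
    exact ⟨t, ⟨EReal.coe_lt_coe_iff.1 ((le_max_left _ _).trans_lt ht1), ht2⟩,
      EReal.coe_lt_coe_iff.1 ((le_max_right _ _).trans_lt ht1)⟩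
  -- Since `F → 1` at the endpoint without a jump, `F` exceeds `q` somewhere in `D`, and the
  -- intermediate value theorem applies.
  have hsolve : ∀ b ∈ D, ∀ q, F b < q → q < 1 → ∃ t ∈ D, b < t ∧ F t = q := by
    intro b hb q hq1 hq2
    obtain ⟨e, he, hFe⟩ := exists_real_of_eventually_leftOfEndpoint hbot
      (h.no_atom.eventually_const_lt hq2)
    obtain ⟨s, hs, hes⟩ := hpick e he
    have hbs : b ≤ s := by
      by_contra! hlt
      exact absurd (hFm hlt.le) (not_le.2 (hq1.trans (hFe s hes hs.2)))
    obtain ⟨t, ht, htq⟩ := intermediate_value_Icc hbs (hcont.mono (hDconn.out hb hs))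
      ⟨hq1.le, (hFe s hes hs.2).le⟩
    refine ⟨t, hDconn.out hb hs ht, lt_of_le_of_ne ht.1 ?_, htq⟩
    rintro rfl
    exact hq1.ne htq
  -- `a` is not in `D`, so a base point inside `D` is needed; `x₀` is its level, beyond which `A`
  -- takes values above `a₀`.
  obtain ⟨a₀, ha₀, -⟩ := hpick a ha
  set x₀ := -Real.log (1 - F a₀) with hx₀
  have hx₀lt : ∀ x, x₀ < x → F a₀ < 1 - Real.exp (-x) := fun x hx => by
    have h1 : Real.exp (-x) < 1 - F a₀ := by
      rw [← Real.lt_log_iff_exp_lt (by linarith [hlt1 a₀ ha₀])]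
      linarith
    linarith
  set A : ℝ → ℝ := fun x => (quantile μ (1 - Real.exp (-x))).toReal with hA
  have key : ∀ b ∈ D, ∀ x, F b < 1 - Real.exp (-x) →
      A x ∈ D ∧ b < A x ∧ F (A x) = 1 - Real.exp (-x) ∧
        quantile μ (1 - Real.exp (-x)) = A x := by
    intro b hb x hx
    obtain ⟨t, ht, hbt, hFt⟩ := hsolve b hb _ hx (by linarith [Real.exp_pos (-x)])
    have hAt : A x = t := by
      simp only [hA]
      rw [← hFt, hquant t ht, EReal.toReal_coe]
    rw [hAt]
    exact ⟨ht, hbt, hFt, hFt ▸ hquant t ht⟩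
  have key₀ : ∀ x, x₀ < x → _ := fun x hx => key a₀ ha₀ x (hx₀lt x hx)
  have hAmono : StrictMonoOn A (Ioi x₀) := fun x hx y hy hxy => by
    by_contra! hle
    have h1 := hFm hle
    rw [(key₀ x hx).2.2.1, (key₀ y hy).2.2.1] at h1
    have := Real.exp_lt_exp.2 (neg_lt_neg hxy)
    linarith
  have hAimage : ∀ t ∈ D, a₀ < t → t ∈ A '' Ioi x₀ := fun t ht hat => by
    have h1 := hlt1 t ht
    have h2 := hmono ha₀ ht hat
    refine ⟨-Real.log (1 - F t), ?_, ?_⟩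
    · exact neg_lt_neg (Real.log_lt_log (by linarith) (by linarith))
    · show (quantile μ (1 - Real.exp (- -Real.log (1 - F t)))).toReal = t
      rw [neg_neg, Real.exp_log (by linarith), sub_sub_cancel, hquant t ht, EReal.toReal_coe]
  -- A monotone function whose image contains a neighbourhood of its value cannot jump there.
  have hAcont : ∀ x, x₀ < x → ContinuousAt A x := fun x hx =>
    hAmono.continuousAt_of_image_mem_nhds (Ioi_mem_nhds hx)
      (mem_of_superset ((hDopen.inter isOpen_Ioi).mem_nhds ⟨(key₀ x hx).1, (key₀ x hx).2.1⟩)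
        fun t ht => hAimage t ht.1 ht.2)
  set g : ℝ → ℝ := fun t => (1 - F t) / deriv F t with hg
  have hgpos : ∀ t ∈ D, 0 < g t := fun t ht =>
    div_pos (by linarith [hlt1 t ht]) (hpos t ht)
  have hgdiff : ∀ t ∈ D, HasDerivAt g (deriv g t) t := fun t ht =>
    (((hdiff t ht).const_sub 1).div (hdiff2 t ht) (hpos t ht).ne').hasDerivAt
  have hAderiv : ∀ x, x₀ < x → HasDerivAt A (g (A x)) x := fun x hx => by
    have hm := (key₀ x hx).1
    have h1 : (1 - F (A x)) ≠ 0 := by linarith [hlt1 _ hm]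
    -- `A` is a local inverse of `-log (1 - F)`, whose derivative is `f / (1 - F) = 1 / g`.
    have hf : HasDerivAt (fun t => -Real.log (1 - F t)) (g (A x))⁻¹ (A x) := by
      refine ((((hdiff _ hm).hasDerivAt.const_sub 1).log h1).neg).congr_deriv ?_
      simp only [hg, inv_div]
      ring
    have := hf.of_local_left_inverse (hAcont x hx) (inv_ne_zero (hgpos _ hm).ne')
      ((eventually_gt_nhds hx).mono fun y hy => by
        rw [(key₀ y hy).2.2.1, sub_sub_cancel, Real.log_exp, neg_neg])
    rwa [inv_inv] at this
  have hAtend : Tendsto A atTop (leftOfEndpoint μ) := by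
    refine tendsto_leftOfEndpoint hbot ?_ fun b hb => ?_
    · filter_upwards [eventually_gt_atTop x₀] with x hx using (key₀ x hx).1.2
    · obtain ⟨t, ht, hbt⟩ := hpick b hb
      have hlim : Tendsto (fun x : ℝ => 1 - Real.exp (-x)) atTop (𝓝 1) := by
        simpa using (Real.tendsto_exp_neg_atTop_nhds_zero).const_sub 1
      filter_upwards [hlim.eventually_const_lt (hlt1 t ht)] with x hx
      exact hbt.trans (key t ht x hx).2.1
  refine ⟨A, fun x => g (A x), fun x => deriv g (A x), h.tendsto_index.comp hAtend, ?_⟩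
  filter_upwards [eventually_gt_atTop x₀] with x hx
  have hm := (key₀ x hx).1
  refine ⟨(key₀ x hx).2.2.2, hAderiv x hx, hgpos _ hm, ?_, ?_⟩
  · have := ((hgdiff _ hm).comp x (hAderiv x hx)).log (hgpos _ hm).ne'
    rwa [Function.comp_apply, mul_div_cancel_right₀ _ (hgpos _ hm).ne'] at this
  · have hev : tailQuantile μ =ᶠ[𝓝 (Real.exp x)] fun t => A (Real.log t) := by
      filter_upwards [eventually_gt_nhds (Real.exp_pos x)] with t ht
      simp only [hA]
      rw [tailQuantile_eq_toReal_quantile μ ht, Real.exp_neg, Real.exp_log ht, one_div]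
    have h2 : HasDerivAt (fun t => A (Real.log t)) (g (A x) * (Real.exp x)⁻¹) (Real.exp x) := by
      refine HasDerivAt.comp (h₂ := A) (h := Real.log) (Real.exp x) ?_
        (Real.hasDerivAt_log (Real.exp_pos x).ne')
      rw [Real.log_exp]
      exact hAderiv x hx
    rw [hev.deriv_eq, h2.deriv]
    field_simp

/-- If `(log c)' → γ > γ'` at infinity, then `c` eventually dominates `x ↦ exp (γ' x)`. -/
lemma eventually_exp_mul_le {c d : ℝ → ℝ} {γ γ' : ℝ} (hγ : γ' < γ) (hd : Tendsto d atTop (𝓝 γ))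
    (hc : ∀ᶠ x in atTop, 0 < c x ∧ HasDerivAt (fun y => Real.log (c y)) (d x) x) :
    ∀ᶠ x in atTop, Real.exp (γ' * x) ≤ c x := by
  -- The slope `m` is strictly above `γ'` so that the linear gain `(m - γ') x` absorbs the
  -- integration constant.
  obtain ⟨m, hm1, hm2⟩ := exists_between hγ
  obtain ⟨x₁, hx₁⟩ := eventually_atTop.1 (hc.and (hd.eventually_const_lt hm2))
  have hinc : ∀ x, x₁ ≤ x → m * (x - x₁) ≤ Real.log (c x) - Real.log (c x₁) := fun x hx => by
    refine Convex.mul_sub_le_image_sub_of_le_deriv (convex_Ici x₁)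
      (fun y hy => (hx₁ y hy).1.2.continuousAt.continuousWithinAt)
      (fun y hy => (hx₁ y (interior_subset hy)).1.2.differentiableAt.differentiableWithinAt)
      (fun y hy => ?_) x₁ self_mem_Ici x hx hx
    rw [(hx₁ y (interior_subset hy)).1.2.deriv]
    exact (hx₁ y (interior_subset hy)).2.le
  have hlin : Tendsto (fun x : ℝ => (m - γ') * x) atTop atTop :=
    tendsto_id.const_mul_atTop (by linarith)
  filter_upwards [eventually_ge_atTop x₁,
    hlin.eventually_ge_atTop (m * x₁ - Real.log (c x₁))] with x hx hx2
  rw [← Real.le_log_iff_exp_le (hx₁ x hx).1.1]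
  linarith [hinc x hx]

/-- If `A' = c > 0` and `(log c)'` is bounded near infinity, then `A` is Lipschitz on `[x - 2, x + 2]`
with constant a fixed multiple of `c x`. -/
lemma exists_abs_sub_le_mul {A c d : ℝ → ℝ} {γ : ℝ} (hd : Tendsto d atTop (𝓝 γ))
    (hc : ∀ᶠ x in atTop, HasDerivAt A (c x) x ∧ 0 < c x ∧
      HasDerivAt (fun y => Real.log (c y)) (d x) x) :
    ∃ C > 0, ∀ᶠ x in atTop, ∀ y ∈ Icc (x - 2) (x + 2), ∀ z ∈ Icc (x - 2) (x + 2),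
      |A y - A z| ≤ C * c x * |y - z| := by
  obtain ⟨x₁, hx₁⟩ := eventually_atTop.1 (hc.and (hd.abs.eventually_lt_const (lt_add_one |γ|)))
  set K := |γ| + 1
  refine ⟨Real.exp (K * 2), Real.exp_pos _, ?_⟩
  filter_upwards [eventually_ge_atTop (x₁ + 2)] with x hx y hy z hz
  -- `log c` is `K`-Lipschitz beyond `x₁`, hence moves by at most `2 K` from the centre of the
  -- window.
  have hlog : ∀ w ∈ Icc (x - 2) (x + 2), ‖c w‖ ≤ Real.exp (K * 2) * c x := fun w hw => by
    have hwx : |w - x| ≤ 2 := abs_le.2 ⟨by linarith [hw.1], by linarith [hw.2]⟩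
    have h1 := Convex.norm_image_sub_le_of_norm_hasDerivWithin_le
      (f := fun y => Real.log (c y)) (f' := d) (s := Ici x₁) (C := K) (x := x) (y := w)
      (fun y hy => (hx₁ y hy).1.2.2.hasDerivWithinAt) (fun y hy => (hx₁ y hy).2.le)
      (convex_Ici x₁) (by simp only [mem_Ici]; linarith)
      (by simp only [mem_Ici]; linarith [hw.1])
    have hcw := (hx₁ w (by linarith [hw.1])).1.2.1
    have hcx := (hx₁ x (by linarith)).1.2.1
    have h2 : Real.log (c w) - Real.log (c x) ≤ K * 2 :=
      (le_abs_self _).trans (h1.trans (mul_le_mul_of_nonneg_left hwx (by positivity)))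
    rw [Real.norm_of_nonneg hcw.le, ← Real.log_le_log_iff hcw (by positivity),
      Real.log_mul (Real.exp_pos _).ne' hcx.ne', Real.log_exp]
    linarith
  exact Convex.norm_image_sub_le_of_norm_hasDerivWithin_le
    (fun w hw => (hx₁ w (by linarith [hw.1])).1.1.hasDerivWithinAt) hlog (convex_Icc _ _) hz hy

/-! ### Order statistics of iid uniform variables. -/

lemma card_filter_le_eq_sum_indicator (N : ℕ) (x : ℕ → ℝ) (t : ℝ) :
    (((Finset.range N).filter (fun i => x i ≤ t)).card : ℝ) =
      ∑ i ∈ Finset.range N, (Iic t).indicator 1 (x i) := by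
  rw [Finset.card_filter]
  push_cast
  exact Finset.sum_congr rfl fun i _ => by simp [indicator_apply]

/-- With `k ≥ 1` some sample point lies below `t`; for `k = 0` the set is all of `ℝ`. -/
lemma orderStat_bddBelow {N k : ℕ} (hk : 1 ≤ k) (x : ℕ → ℝ) :
    BddBelow {t : ℝ | k ≤ ((Finset.range N).filter (fun i => x i ≤ t)).card} := by
  refine ⟨-∑ i ∈ Finset.range N, |x i|, fun t ht => ?_⟩
  obtain ⟨i, hi⟩ := Finset.card_pos.1 (lt_of_lt_of_le hk ht)
  rw [Finset.mem_filter] at hi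
  have h1 := Finset.single_le_sum (f := fun i => |x i|) (fun i _ => abs_nonneg _) hi.1
  have h2 := neg_abs_le (x i)
  linarith [hi.2]

lemma orderStat_le {N k : ℕ} (hk : 1 ≤ k) {x : ℕ → ℝ} {t : ℝ}
    (h : k ≤ ((Finset.range N).filter (fun i => x i ≤ t)).card) : orderStat N k x ≤ t :=
  csInf_le (orderStat_bddBelow hk x) h

lemma le_orderStat {N k : ℕ} (hkN : k ≤ N) {x : ℕ → ℝ} {t : ℝ}
    (h : ((Finset.range N).filter (fun i => x i ≤ t)).card < k) : t ≤ orderStat N k x := by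
  refine le_csInf ⟨∑ i ∈ Finset.range N, |x i|, ?_⟩ fun s hs => ?_
  · rw [mem_ofPred_eq, Finset.filter_true_of_mem, Finset.card_range]
    · exact hkN
    · exact fun i hi => (le_abs_self _).trans
        (Finset.single_le_sum (f := fun i => |x i|) (fun i _ => abs_nonneg _) hi)
  · by_contra! hlt
    refine absurd (hs.trans (Finset.card_le_card ?_)) (not_le.2 h)
    exact Finset.monotone_filter_right _ fun i _ hi => hi.trans hlt.le

section Uniform

variable {Ω : Type*} [MeasurableSpace Ω] {P : Measure Ω} [IsProbabilityMeasure P] {U : ℕ → Ω → ℝ}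

/-- Chebyshev's inequality for the empirical distribution function of iid uniform variables. -/
lemma measure_abs_card_sub_le (hU : iIndepFun U P)
    (hunif : ∀ i, pdf.IsUniform (U i) (Icc (0 : ℝ) 1) P volume) (N : ℕ) {t s : ℝ}
    (ht : t ∈ Icc (0 : ℝ) 1) (hs : 0 < s) :
    P {ω | s ≤ |(((Finset.range N).filter (fun i => U i ω ≤ t)).card : ℝ) - N * t|} ≤
      ENNReal.ofReal (N * t / s ^ 2) := by
  have hmeas : ∀ i, AEMeasurable (U i) P := fun i =>
    pdf.IsUniform.aemeasurable (by simp) (by simp) (hunif i)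
  set f : ℝ → ℝ := (Iic t).indicator 1 with hf
  have hfm : Measurable f := measurable_one.indicator measurableSet_Iic
  have hfb : ∀ x, ‖f x‖ ≤ 1 := fun x => by
    by_cases hx : x ∈ Iic t <;> simp [hf, hx]
  have hLp : ∀ i, MemLp (f ∘ U i) 2 P := fun i =>
    MemLp.of_bound (hfm.comp_aemeasurable (hmeas i)).aestronglyMeasurable 1
      (ae_of_all _ fun ω => hfb _)
  have hmean : ∀ i, ∫ ω, f (U i ω) ∂P = t := fun i => by
    rw [← integral_map (hmeas i) hfm.aestronglyMeasurable, hunif i, hf,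
      integral_indicator_one measurableSet_Iic]
    rw [measureReal_def, cond_apply measurableSet_Icc,
      show Icc (0 : ℝ) 1 ∩ Iic t = Icc 0 t from
        Set.ext fun x => ⟨fun h => ⟨h.1.1, h.2⟩, fun h => ⟨⟨h.1, h.2.trans ht.2⟩, h.2⟩⟩]
    simp [ht.1]
  -- An indicator equals its square, so its second moment is its mean.
  have hvar : ∀ i, Var[f ∘ U i; P] ≤ t := fun i => by
    refine (variance_le_expectation_sq (hLp i).aestronglyMeasurable).trans ?_
    rw [← hmean i]
    refine le_of_eq (integral_congr_ae (ae_of_all _ fun ω => ?_))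
    by_cases hx : U i ω ∈ Iic t <;> simp [hf, hx]
  have hsum : Var[∑ i ∈ Finset.range N, f ∘ U i; P] ≤ N * t := by
    rw [IndepFun.variance_sum (fun i _ => hLp i)
      fun i _ j _ hij => (hU.indepFun hij).comp hfm hfm]
    exact (Finset.sum_le_sum fun i _ => hvar i).trans (by simp)
  have hS : MemLp (∑ i ∈ Finset.range N, f ∘ U i) 2 P := memLp_finsetSum' _ fun i _ => hLp i
  have hES : ∫ ω, (∑ i ∈ Finset.range N, f ∘ U i) ω ∂P = N * t := by
    simp only [Finset.sum_apply, Function.comp_apply]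
    rw [integral_finsetSum (f := fun i ω => f (U i ω)) _ fun i _ => (hLp i).integrable (by norm_num)]
    simp [hmean]
  have := meas_ge_le_variance_div_sq hS hs
  rw [hES] at this
  simp only [Finset.sum_apply, Function.comp_apply, hf,
    ← card_filter_le_eq_sum_indicator] at this
  refine this.trans (ENNReal.ofReal_le_ofReal ?_)
  gcongr

/-- With high probability `U_{k,N}` lies between `k / (2 N)` and `2 k / N`. -/
lemma measure_orderStat_notMem_le (hU : iIndepFun U P)
    (hunif : ∀ i, pdf.IsUniform (U i) (Icc (0 : ℝ) 1) P volume) {N k : ℕ} (hk : 1 ≤ k)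
    (hkN : 2 * k ≤ N) :
    P {ω | orderStat N k (fun i => U i ω) ∉ Icc ((k : ℝ) / (2 * N)) (2 * k / N)} ≤
      ENNReal.ofReal (4 / k) := by
  have hk0 : (0 : ℝ) < k := by exact_mod_cast hk
  have hkN' : 2 * (k : ℝ) ≤ N := by exact_mod_cast hkN
  have hN0 : (0 : ℝ) < N := by linarith
  have ht1 : (2 * k / N : ℝ) ∈ Icc (0 : ℝ) 1 := ⟨by positivity, (div_le_one hN0).2 hkN'⟩
  have ht2 : ((k : ℝ) / (2 * N)) ∈ Icc (0 : ℝ) 1 :=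
    ⟨by positivity, (div_le_one (by positivity)).2 (by linarith)⟩
  -- The expected counts at the two ends are `2k` and `k / 2`, so missing `k` takes deviations `k`
  -- and `k / 2`; each has probability at most `2 / k`.
  have h1 := measure_abs_card_sub_le hU hunif N ht1 hk0
  have h2 := measure_abs_card_sub_le hU hunif N ht2 (half_pos hk0)
  have e1 : (N : ℝ) * (2 * k / N) = 2 * k := by field_simp
  have e2 : (N : ℝ) * (k / (2 * N)) = k / 2 := by field_simp
  rw [e1] at h1
  rw [e2] at h2
  have h3 : ENNReal.ofReal (2 * k / (k : ℝ) ^ 2) + ENNReal.ofReal ((k : ℝ) / 2 / (k / 2) ^ 2) =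
      ENNReal.ofReal (4 / k) := by
    rw [← ENNReal.ofReal_add (by positivity) (by positivity)]
    congr 1
    field_simp
    norm_num
  rw [← h3]
  refine (measure_mono fun ω hω => ?_).trans ((measure_union_le _ _).trans (add_le_add h1 h2))
  by_contra hcon
  rw [mem_union, not_or] at hcon
  obtain ⟨c1, c2⟩ := hcon
  simp only [mem_ofPred_eq, not_le, abs_lt] at c1 c2
  refine hω ⟨le_orderStat (by lia) ?_, orderStat_le hk ?_⟩
  · have : ((((Finset.range N).filter (fun i => U i ω ≤ (k : ℝ) / (2 * N))).card : ℕ) : ℝ) < k := by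
      linarith [c2.2]
    exact_mod_cast this
  · have : (k : ℝ) ≤ (((Finset.range N).filter (fun i => U i ω ≤ 2 * (k : ℝ) / N)).card : ℕ) := by
      linarith [c1.1]
    exact_mod_cast this

end Uniform

/-! ### Tail bounds for the noise. -/

/-- The level `1 / 2` serves twice: it bounds quantiles on one side of the median, and it controls
the mean and variance of Gaussian noise. -/
lemma exists_measure_abs_lt_half {ι : Type*} {s : Set ι} {μ : ι → Measure ℝ}
    (h : IsTightMeasureSet (μ '' s)) :
    ∃ M : ℝ, 1 ≤ M ∧ ∀ i ∈ s, (μ i).real {x | M < |x|} < 1 / 2 := by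
  have h1 := isTightMeasureSet_iff_tendsto_measure_norm_gt.1 h
  have h2 : (0 : ℝ≥0∞) < ENNReal.ofReal (1 / 2) := by simp
  obtain ⟨M, hM, hM1⟩ := ((h1.eventually_lt_const h2).and (eventually_ge_atTop 1)).exists
  refine ⟨M, hM1, fun i hi => ?_⟩
  refine ENNReal.toReal_lt_of_lt_ofReal (lt_of_le_of_lt ?_ hM)
  exact le_iSup₂ (f := fun ν (_ : ν ∈ μ '' s) => ν {x | M < ‖x‖}) (μ i) ⟨i, hi, rfl⟩

/-- Markov's inequality; `C + 1` in place of `C` makes the conclusion strict. -/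
lemma measure_abs_lt_of_lintegral_le {μ : Measure ℝ} {β C u : ℝ} (hβ : 0 < β) (hC : 0 ≤ C)
    (hu : 0 < u) (h : ∫⁻ x, ‖x‖ₑ ^ β ∂μ ≤ ENNReal.ofReal C) :
    μ.real {x | ((C + 1) / u) ^ (1 / β) < |x|} < u := by
  have hq : 0 < (C + 1) / u := by positivity
  have h1 := mul_meas_ge_le_lintegral₀ (μ := μ) (f := fun x : ℝ => ‖x‖ₑ ^ β)
    (by fun_prop) (ENNReal.ofReal ((C + 1) / u))
  have h2 : {x : ℝ | ((C + 1) / u) ^ (1 / β) < |x|} ⊆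
      {x | ENNReal.ofReal ((C + 1) / u) ≤ ‖x‖ₑ ^ β} := fun x hx => by
    have hx' : ((C + 1) / u) ^ (1 / β) < |x| := hx
    rw [mem_ofPred_eq, Real.enorm_eq_ofReal_abs, ENNReal.ofReal_rpow_of_nonneg (abs_nonneg _) hβ.le]
    refine ENNReal.ofReal_le_ofReal ?_
    have := Real.rpow_le_rpow (by positivity) hx'.le hβ.le
    rwa [← Real.rpow_mul hq.le, one_div_mul_cancel hβ.ne', Real.rpow_one] at this
  have h3 : μ {x : ℝ | ((C + 1) / u) ^ (1 / β) < |x|} ≤ ENNReal.ofReal (C / ((C + 1) / u)) := by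
    rw [ENNReal.ofReal_div_of_pos hq, ENNReal.le_div_iff_mul_le (by simp [hq]) (by simp), mul_comm]
    exact (mul_le_mul_right (measure_mono h2) _).trans (h1.trans h)
  refine (ENNReal.toReal_le_of_le_ofReal (by positivity) h3).trans_lt ?_
  rw [div_lt_iff₀ hq, mul_div_cancel₀ _ hu.ne']
  linarith

lemma measure_Ici_eq_measure_Iic_gaussianReal (m : ℝ) (v : ℝ≥0) :
    gaussianReal m v (Iic m) = gaussianReal m v (Ici m) := by
  have h := gaussianReal_map_const_sub (μ := m) (v := v) (2 * m)
  rw [two_mul, add_sub_cancel_right] at h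
  nth_rewrite 1 [← h]
  rw [Measure.map_apply (by fun_prop) measurableSet_Iic]
  congr 1
  ext x
  simp only [mem_preimage, mem_Iic, mem_Ici]
  constructor <;> intro h <;> linarith

/-- If `|m| > M`, a half-line starting at `m`, of mass at least `1 / 2` by symmetry, lies in `{M <
|x|}`. -/
lemma abs_mean_le_of_measure_abs_lt_half {m M : ℝ} {v : ℝ≥0}
    (h : (gaussianReal m v).real {x | M < |x|} < 1 / 2) : |m| ≤ M := by
  by_contra! hm
  have h1 : (1 : ℝ) ≤ (gaussianReal m v).real (Iic m) + (gaussianReal m v).real (Ici m) := by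
    rw [← probReal_univ (μ := gaussianReal m v), ← Iic_union_Ici (a := m)]
    exact measureReal_union_le _ _
  have h2 : (gaussianReal m v).real (Iic m) = (gaussianReal m v).real (Ici m) := by
    rw [measureReal_def, measureReal_def, measure_Ici_eq_measure_Iic_gaussianReal]
  rcases lt_abs.1 hm with hm | hm
  · have : (gaussianReal m v).real (Ici m) ≤ (gaussianReal m v).real {x | M < |x|} :=
      measureReal_mono fun x (hx : m ≤ x) => lt_abs.2 (Or.inl (hm.trans_le hx))
    linarith
  · have : (gaussianReal m v).real (Iic m) ≤ (gaussianReal m v).real {x | M < |x|} :=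
      measureReal_mono fun x (hx : x ≤ m) => lt_abs.2 (Or.inr (hm.trans_le (neg_le_neg hx)))
    linarith

/-- A larger variance would push the density below `1 / (4M)`, leaving mass at most `1 / 2` on `[-M,
M]`. -/
lemma variance_le_of_measure_abs_lt_half {m M : ℝ} {v : ℝ≥0} (hM : 0 < M)
    (h : (gaussianReal m v).real {x | M < |x|} < 1 / 2) : (v : ℝ) ≤ (4 * M) ^ 2 := by
  by_contra! hv
  have hv0 : (0 : ℝ) < v := lt_of_le_of_lt (by positivity) hv
  have hvne : v ≠ 0 := fun h0 => by simp [h0] at hv0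
  have hpdf : ∀ x, gaussianPDF m v x ≤ ENNReal.ofReal (1 / (4 * M)) := fun x => by
    refine ENNReal.ofReal_le_ofReal ?_
    rw [gaussianPDFReal]
    have h1 : Real.exp (-(x - m) ^ 2 / (2 * v)) ≤ 1 :=
      Real.exp_le_one_iff.2 (div_nonpos_of_nonpos_of_nonneg (by nlinarith [sq_nonneg (x - m)])
        (by positivity))
    have h2 : 4 * M ≤ √(2 * Real.pi * v) := by
      refine Real.le_sqrt_of_sq_le (hv.le.trans ?_)
      nlinarith [Real.pi_gt_three]
    calc (√(2 * Real.pi * v))⁻¹ * Real.exp (-(x - m) ^ 2 / (2 * v))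
        ≤ (√(2 * Real.pi * v))⁻¹ * 1 := by gcongr
      _ ≤ 1 / (4 * M) := by
        rw [mul_one, one_div]
        exact inv_anti₀ (by positivity) h2
  have hI : gaussianReal m v (Icc (-M) M) ≤ ENNReal.ofReal (1 / 2) := by
    rw [gaussianReal_apply m hvne]
    refine (lintegral_mono hpdf).trans ?_
    rw [lintegral_const, Measure.restrict_apply_univ, Real.volume_Icc,
      ← ENNReal.ofReal_mul (by positivity)]
    refine ENNReal.ofReal_le_ofReal (le_of_eq ?_)
    field_simp
    ring
  have hI' : (gaussianReal m v).real (Icc (-M) M) ≤ 1 / 2 :=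
    ENNReal.toReal_le_of_le_ofReal (by norm_num) hI
  have h3 := probReal_compl_eq_one_sub (μ := gaussianReal m v) (measurableSet_Icc (a := -M) (b := M))
  have h4 : (Icc (-M) M)ᶜ = {x | M < |x|} := by
    ext x
    simp only [mem_compl_iff, mem_Icc, ← abs_le, not_le, mem_ofPred_eq]
  rw [h4] at h3
  linarith

lemma hasSubgaussianMGF_gaussianReal {m : ℝ} {v w : ℝ≥0} (h : v ≤ w) :
    HasSubgaussianMGF (fun x => x - m) w (gaussianReal m v) := by
  have hmap : (gaussianReal m v).map (fun x => x - m) = gaussianReal 0 v := by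
    rw [gaussianReal_map_sub_const, sub_self]
  refine ⟨fun t => ?_, fun t => ?_⟩
  · have := integrable_exp_mul_gaussianReal (μ := 0) (v := v) t
    rw [← hmap] at this
    exact this.comp_measurable (by fun_prop)
  · rw [mgf_gaussianReal hmap, zero_mul, zero_add]
    have : (v : ℝ) ≤ w := h
    gcongr

lemma measure_abs_lt_of_gaussianReal {m M u : ℝ} {v : ℝ≥0} (hM : 0 < M) (hu : 0 < u) (hu1 : u ≤ 1)
    (h : (gaussianReal m v).real {x | M < |x|} < 1 / 2) :
    (gaussianReal m v).real {x | M + 4 * M * √(2 * Real.log (4 / u)) < |x|} < u := by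
  have hm := abs_mean_le_of_measure_abs_lt_half h
  have hv := variance_le_of_measure_abs_lt_half hM h
  set w : ℝ≥0 := ⟨(4 * M) ^ 2, by positivity⟩ with hw
  have hsub := hasSubgaussianMGF_gaussianReal (m := m) (v := v) (w := w) hv
  set y := 4 * M * √(2 * Real.log (4 / u)) with hy
  have hy0 : 0 ≤ y := by positivity
  have hlog : 0 ≤ Real.log (4 / u) := Real.log_nonneg (by rw [le_div_iff₀ hu]; linarith)
  -- `y` is chosen so that each one-sided sub-Gaussian bound is `u / 4`; the two add up to `u / 2 <
  -- u`.
  have hexp : Real.exp (-y ^ 2 / (2 * w)) = u / 4 := by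
    have : -y ^ 2 / (2 * w) = -Real.log (4 / u) := by
      have hw' : (w : ℝ) = (4 * M) ^ 2 := rfl
      rw [hw', hy, mul_pow, Real.sq_sqrt (by positivity)]
      field_simp
    rw [this, Real.exp_neg, Real.exp_log (by positivity), inv_div]
  have h1 := hsub.measure_ge_le hy0
  have h2 := hsub.neg.measure_ge_le hy0
  rw [hexp] at h1 h2
  have h3 : (gaussianReal m v).real {x | M + y < |x|} ≤
      (gaussianReal m v).real ({x | y ≤ x - m} ∪ {x | y ≤ (-fun x => x - m) x}) := by
    refine measureReal_mono fun x hx => ?_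
    have hx' : M + y < |x| := hx
    have hm' := abs_le.1 hm
    rcases lt_abs.1 hx' with h | h
    · left
      show y ≤ x - m
      linarith
    · right
      show y ≤ -(x - m)
      linarith
  have h4 := measureReal_union_le (μ := gaussianReal m v) {x | y ≤ x - m}
    {x | y ≤ (-fun x => x - m) x}
  linarith

/-! ### Growth rates of `k` and `N / k`. -/

section Growth

variable {k : ℕ → ℕ} {δ : ℝ}

lemma eventually_one_le_of_tendsto (hk : Tendsto (fun N : ℕ => (k N : ℝ) / (N : ℝ) ^ δ) atTop (𝓝 1)) :
    ∀ᶠ N in atTop, 1 ≤ k N := by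
  filter_upwards [hk.eventually_const_lt zero_lt_one] with N hN
  by_contra! h0
  simp [Nat.lt_one_iff.1 h0] at hN

/-- Working with logarithms turns `k ≈ N ^ δ` into a bounded additive error, that is, a constant
factor in every later power bound. -/
lemma eventually_abs_log_sub_le (hk : Tendsto (fun N : ℕ => (k N : ℝ) / (N : ℝ) ^ δ) atTop (𝓝 1)) :
    ∀ᶠ N : ℕ in atTop, |Real.log (k N) - δ * Real.log N| ≤ 1 := by
  have h1 : Tendsto (fun N : ℕ => |Real.log ((k N : ℝ) / (N : ℝ) ^ δ)|) atTop (𝓝 0) := by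
    simpa using (hk.log one_ne_zero).abs
  filter_upwards [h1.eventually_lt_const zero_lt_one, eventually_one_le_of_tendsto hk,
    eventually_ge_atTop 1] with N hN hk1 hN1
  have hN0 : (0 : ℝ) < N := by exact_mod_cast hN1
  have hk0 : (0 : ℝ) < k N := by exact_mod_cast hk1
  rw [Real.log_div hk0.ne' (by positivity), Real.log_rpow hN0] at hN
  exact hN.le

lemma tendsto_log_natCast : Tendsto (fun N : ℕ => Real.log N) atTop atTop :=
  Real.tendsto_log_atTop.comp tendsto_natCast_atTop_atTop

lemma tendsto_natCast_of_tendsto_div (hδ : 0 < δ)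
    (hk : Tendsto (fun N : ℕ => (k N : ℝ) / (N : ℝ) ^ δ) atTop (𝓝 1)) :
    Tendsto (fun N => (k N : ℝ)) atTop atTop := by
  have h1 : Tendsto (fun N : ℕ => (N : ℝ) ^ δ) atTop atTop :=
    (tendsto_rpow_atTop hδ).comp tendsto_natCast_atTop_atTop
  refine (hk.pos_mul_atTop zero_lt_one h1).congr' ?_
  filter_upwards [eventually_ge_atTop 1] with N hN
  have hN0 : (0 : ℝ) < N := by exact_mod_cast hN
  exact div_mul_cancel₀ _ (by positivity)

lemma tendsto_log_div (hδ : δ < 1)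
    (hk : Tendsto (fun N : ℕ => (k N : ℝ) / (N : ℝ) ^ δ) atTop (𝓝 1)) :
    Tendsto (fun N : ℕ => Real.log (N / k N)) atTop atTop := by
  have h1 : Tendsto (fun N : ℕ => (1 - δ) * Real.log N - 1) atTop atTop :=
    tendsto_atTop_add_const_right _ _ (tendsto_log_natCast.const_mul_atTop (by linarith))
  refine tendsto_atTop_mono' _ ?_ h1
  filter_upwards [eventually_abs_log_sub_le hk, eventually_one_le_of_tendsto hk,
    eventually_ge_atTop 1] with N hN hk1 hN1
  have hN0 : (0 : ℝ) < N := by exact_mod_cast hN1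
  have hk0 : (0 : ℝ) < k N := by exact_mod_cast hk1
  rw [Real.log_div hN0.ne' hk0.ne']
  linarith [(abs_le.1 hN).2]

lemma eventually_two_mul_le (hδ : δ < 1)
    (hk : Tendsto (fun N : ℕ => (k N : ℝ) / (N : ℝ) ^ δ) atTop (𝓝 1)) :
    ∀ᶠ N in atTop, 2 * k N ≤ N := by
  filter_upwards [(tendsto_log_div hδ hk).eventually_ge_atTop (Real.log 2),
    eventually_one_le_of_tendsto hk, eventually_ge_atTop 1] with N hN hk1 hN1
  have hN0 : (0 : ℝ) < N := by exact_mod_cast hN1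
  have hk0 : (0 : ℝ) < k N := by exact_mod_cast hk1
  rw [Real.log_le_log_iff two_pos (by positivity), le_div_iff₀ hk0] at hN
  exact_mod_cast hN

lemma eventually_sqrt_div_le {c : ℝ → ℝ} {γ' : ℝ} (hδ : δ < 1)
    (hk : Tendsto (fun N : ℕ => (k N : ℝ) / (N : ℝ) ^ δ) atTop (𝓝 1))
    (hc : ∀ᶠ x in atTop, Real.exp (γ' * x) ≤ c x) :
    ∀ᶠ N : ℕ in atTop, √(k N : ℝ) / c (Real.log (N / k N)) ≤
      Real.exp (1 / 2 + |γ'|) * (N : ℝ) ^ (δ / 2 + (1 - δ) * (-γ')) := by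
  filter_upwards [(tendsto_log_div hδ hk).eventually hc, eventually_abs_log_sub_le hk,
    eventually_one_le_of_tendsto hk, eventually_ge_atTop 1] with N hcN hlog hk1 hN1
  have hN0 : (0 : ℝ) < N := by exact_mod_cast hN1
  have hk0 : (0 : ℝ) < k N := by exact_mod_cast hk1
  have h1 : √(k N : ℝ) = Real.exp (Real.log (k N) / 2) := by
    rw [← Real.log_sqrt hk0.le, Real.exp_log (Real.sqrt_pos.2 hk0)]
  calc √(k N : ℝ) / c (Real.log (N / k N))
      ≤ √(k N : ℝ) / Real.exp (γ' * Real.log (N / k N)) := by gcongr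
    _ = Real.exp (Real.log (k N) / 2 - γ' * (Real.log N - Real.log (k N))) := by
        rw [h1, ← Real.exp_sub, Real.log_div hN0.ne' hk0.ne']
    _ ≤ Real.exp (1 / 2 + |γ'| + Real.log N * (δ / 2 + (1 - δ) * (-γ'))) := by
        refine Real.exp_le_exp.2 ?_
        have h2 : γ' * (Real.log (k N) - δ * Real.log N) ≤ |γ'| := by
          refine (le_abs_self _).trans ?_
          rw [abs_mul]
          exact mul_le_of_le_one_right (abs_nonneg _) hlog
        nlinarith [(abs_le.1 hlog).2]
    _ = _ := by rw [Real.exp_add, Real.rpow_def_of_pos hN0]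

lemma eventually_div_sqrt_le
    (hk : Tendsto (fun N : ℕ => (k N : ℝ) / (N : ℝ) ^ δ) atTop (𝓝 1)) :
    ∀ᶠ N : ℕ in atTop, (N : ℝ) / √(k N : ℝ) ≤ Real.exp (1 / 2) * (N : ℝ) ^ (1 - δ / 2) := by
  filter_upwards [eventually_abs_log_sub_le hk,
    eventually_one_le_of_tendsto hk, eventually_ge_atTop 1] with N hlog hk1 hN1
  have hN0 : (0 : ℝ) < N := by exact_mod_cast hN1
  have hk0 : (0 : ℝ) < k N := by exact_mod_cast hk1
  have h1 : (N : ℝ) / √(k N : ℝ) = Real.exp (Real.log N - Real.log (k N) / 2) := by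
    rw [Real.exp_sub, Real.exp_log hN0, ← Real.log_sqrt hk0.le, Real.exp_log (Real.sqrt_pos.2 hk0)]
  rw [h1, Real.rpow_def_of_pos hN0, ← Real.exp_add]
  refine Real.exp_le_exp.2 ?_
  nlinarith [(abs_le.1 hlog).1]

end Growth

lemma eventually_level_le_one {k : ℕ → ℕ} {δ : ℝ} (hδ : δ ∈ Ioo (0 : ℝ) 1)
    (hk : Tendsto (fun N : ℕ => (k N : ℝ) / (N : ℝ) ^ δ) atTop (𝓝 1)) (η : ℝ) :
    ∀ᶠ N : ℕ in atTop, η * √(k N : ℝ) / N ≤ 1 := by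
  filter_upwards [eventually_one_le_of_tendsto hk, eventually_two_mul_le hδ.2 hk,
    (tendsto_natCast_of_tendsto_div hδ.1 hk).eventually_ge_atTop (η ^ 2)] with N h1 h2 h3
  have hk0 : (0 : ℝ) < k N := by exact_mod_cast h1
  have h4 : (2 * k N : ℝ) ≤ N := by exact_mod_cast h2
  rw [div_le_one (by linarith)]
  nlinarith [Real.mul_self_sqrt hk0.le, Real.sqrt_nonneg (k N : ℝ), Real.le_sqrt_of_sq_le h3]

lemma tendsto_zero_of_le_mul {α : Type*} {l : Filter α} {f g : α → ℝ} (C : ℝ)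
    (hg : Tendsto g l (𝓝 0)) (hf0 : ∀ᶠ a in l, 0 ≤ f a) (hfg : ∀ᶠ a in l, f a ≤ C * g a) :
    Tendsto f l (𝓝 0) :=
  tendsto_of_tendsto_of_tendsto_of_le_of_le' tendsto_const_nhds
    (by simpa using hg.const_mul C) hf0 hfg

/-! ### The rate conditions make the noise negligible. -/

section Rate

variable {μ : ℕ → Measure ℝ} {k : ℕ → ℕ} {δ γ' p : ℝ} {c : ℝ → ℝ} {L : Filter (ℕ × ℕ)}

/-- The noise level `r = √k / (c T ^ p)` relative to the scale `c` of the latent tail. -/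
noncomputable def relNoise (c : ℝ → ℝ) (k : ℕ → ℕ) (p : ℝ) (a : ℕ × ℕ) : ℝ :=
  √(k a.1 : ℝ) / c (Real.log (a.1 / k a.1)) * (1 / (a.2 : ℝ) ^ p)

/-- Markov at level `η √k / N` gives `b` of order `N ^ ((1 - δ / 2) / β)`; times `√k / c`, this
yields the exponent of the rate condition up to the surplus `ν / β`. -/
lemma relNoise_bound_moment {β C ν : ℝ} (hβ : 0 < β) (hC : 0 ≤ C) (hν : 0 < ν)
    (hδ : δ ∈ Ioo (0 : ℝ) 1)
    (hk : Tendsto (fun N : ℕ => (k N : ℝ) / (N : ℝ) ^ δ) atTop (𝓝 1))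
    (hc : ∀ᶠ x in atTop, Real.exp (γ' * x) ≤ c x)
    (hN : Tendsto Prod.fst L atTop) (hT : Tendsto Prod.snd L atTop)
    (hμ : ∀ T ≥ 1, ∫⁻ x, ‖x‖ₑ ^ β ∂(μ T) ≤ ENNReal.ofReal C)
    (hrate : Tendsto (fun a : ℕ × ℕ =>
      (a.1 : ℝ) ^ (δ / 2 * (1 + 1 / β) + (1 - δ) * (-γ' + 1 / β) + ν / β) / (a.2 : ℝ) ^ p) L (𝓝 0))
    {η : ℝ} (hη : 0 < η) :
    ∃ b : ℕ × ℕ → ℝ, (∀ᶠ a in L, 1 ≤ b a) ∧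
      (∀ᶠ a in L, (μ a.2).real {x | b a < |x|} < η * √(k a.1) / a.1) ∧
      Tendsto (fun a => relNoise c k p a * b a) L (𝓝 0) := by
  refine ⟨fun a => ((C + 1) / (η * √(k a.1) / a.1)) ^ (1 / β), ?_, ?_, ?_⟩
  · filter_upwards [hN.eventually (eventually_level_le_one hδ hk η),
      hN.eventually (eventually_one_le_of_tendsto hk),
      hN.eventually (eventually_ge_atTop 1)] with a h0 h1 h2
    have hN0 : (0 : ℝ) < a.1 := by exact_mod_cast h2
    have hk0 : (0 : ℝ) < k a.1 := by exact_mod_cast h1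
    refine Real.one_le_rpow ?_ (by positivity)
    rw [le_div_iff₀ (by positivity)]
    linarith
  · filter_upwards [hN.eventually (eventually_one_le_of_tendsto hk),
      hN.eventually (eventually_ge_atTop 1), hT.eventually (eventually_ge_atTop 1)] with a h1 h2 h3
    have hN0 : (0 : ℝ) < a.1 := by exact_mod_cast h2
    have hk0 : (0 : ℝ) < k a.1 := by exact_mod_cast h1
    exact measure_abs_lt_of_lintegral_le hβ hC (by positivity) (hμ _ h3)
  · refine tendsto_zero_of_le_mul
      (Real.exp (1 / 2 + |γ'|) * ((C + 1) / η * Real.exp (1 / 2)) ^ (1 / β)) hrate ?_ ?_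
    all_goals
      filter_upwards [hN.eventually (eventually_one_le_of_tendsto hk),
        hN.eventually (eventually_ge_atTop 1), hT.eventually (eventually_ge_atTop 1),
        hN.eventually (eventually_sqrt_div_le hδ.2 hk hc),
        hN.eventually (eventually_div_sqrt_le hk),
        hN.eventually ((tendsto_log_div hδ.2 hk).eventually hc)] with a h1 h2 h3 h4 h5 h6
      have hN1 : (1 : ℝ) ≤ a.1 := by exact_mod_cast h2
      have hN0 : (0 : ℝ) < a.1 := by linarith
      have hT0 : (0 : ℝ) < a.2 := by exact_mod_cast h3
      have hk0 : (0 : ℝ) < k a.1 := by exact_mod_cast h1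
      have hc0 := (Real.exp_pos _).trans_le h6
      unfold relNoise
    · positivity
    · have e1 : (C + 1) / (η * √(k a.1 : ℝ) / a.1) = (C + 1) / η * (a.1 / √(k a.1 : ℝ)) := by
        field_simp
      have e2 : ((C + 1) / (η * √(k a.1 : ℝ) / a.1)) ^ (1 / β) ≤
          ((C + 1) / η * Real.exp (1 / 2)) ^ (1 / β) * (a.1 : ℝ) ^ ((1 - δ / 2) * (1 / β)) := by
        rw [Real.rpow_mul hN0.le, ← Real.mul_rpow (by positivity) (by positivity), e1, mul_assoc]
        gcongr
      have e3 : (a.1 : ℝ) ^ (δ / 2 + (1 - δ) * (-γ')) * (a.1 : ℝ) ^ ((1 - δ / 2) * (1 / β)) ≤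
          (a.1 : ℝ) ^ (δ / 2 * (1 + 1 / β) + (1 - δ) * (-γ' + 1 / β) + ν / β) := by
        rw [← Real.rpow_add hN0]
        refine Real.rpow_le_rpow_of_exponent_le hN1 ?_
        have : 0 < ν / β := by positivity
        linarith
      calc _ ≤ (Real.exp (1 / 2 + |γ'|) * (a.1 : ℝ) ^ (δ / 2 + (1 - δ) * (-γ'))) *
            (1 / (a.2 : ℝ) ^ p) * (((C + 1) / η * Real.exp (1 / 2)) ^ (1 / β) *
              (a.1 : ℝ) ^ ((1 - δ / 2) * (1 / β))) := by gcongr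
        _ = (Real.exp (1 / 2 + |γ'|) * ((C + 1) / η * Real.exp (1 / 2)) ^ (1 / β)) *
            ((a.1 : ℝ) ^ (δ / 2 + (1 - δ) * (-γ')) * (a.1 : ℝ) ^ ((1 - δ / 2) * (1 / β)) /
              (a.2 : ℝ) ^ p) := by ring
        _ ≤ _ := by gcongr

lemma relNoise_bound_gaussian {M : ℝ} (hM : 1 ≤ M) (hδ : δ ∈ Ioo (0 : ℝ) 1)
    (hk : Tendsto (fun N : ℕ => (k N : ℝ) / (N : ℝ) ^ δ) atTop (𝓝 1))
    (hc : ∀ᶠ x in atTop, Real.exp (γ' * x) ≤ c x)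
    (hN : Tendsto Prod.fst L atTop) (hT : Tendsto Prod.snd L atTop)
    (hμM : ∀ T ≥ 1, (μ T).real {x | M < |x|} < 1 / 2)
    (hμ : ∀ T ≥ 1, ∃ (m : ℝ) (v : ℝ≥0), μ T = gaussianReal m v)
    (hrate : Tendsto (fun a : ℕ × ℕ =>
      (a.1 : ℝ) ^ (δ / 2 + (1 - δ) * (-γ')) * √(Real.log a.1) / (a.2 : ℝ) ^ p) L (𝓝 0))
    {η : ℝ} (hη : 0 < η) :
    ∃ b : ℕ × ℕ → ℝ, (∀ᶠ a in L, 1 ≤ b a) ∧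
      (∀ᶠ a in L, (μ a.2).real {x | b a < |x|} < η * √(k a.1) / a.1) ∧
      Tendsto (fun a => relNoise c k p a * b a) L (𝓝 0) := by
  have hkT := tendsto_natCast_of_tendsto_div hδ.1 hk
  refine ⟨fun a => M + 4 * M * √(2 * Real.log (4 / (η * √(k a.1) / a.1))), ?_, ?_, ?_⟩
  · filter_upwards with a
    have : 0 ≤ 4 * M * √(2 * Real.log (4 / (η * √(k a.1) / a.1))) := by positivity
    linarith
  · filter_upwards [hN.eventually (eventually_one_le_of_tendsto hk),
      hN.eventually (eventually_ge_atTop 1), hT.eventually (eventually_ge_atTop 1),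
      hN.eventually (eventually_level_le_one hδ hk η)] with a h1 h2 h3 h4
    have hN0 : (0 : ℝ) < a.1 := by exact_mod_cast h2
    have hk0 : (0 : ℝ) < k a.1 := by exact_mod_cast h1
    obtain ⟨m, v, hmv⟩ := hμ _ h3
    have h6 := hμM _ h3
    rw [hmv] at h6 ⊢
    exact measure_abs_lt_of_gaussianReal (by linarith) (by positivity) h4 h6
  · refine tendsto_zero_of_le_mul (Real.exp (1 / 2 + |γ'|) * (9 * M)) hrate ?_ ?_
    all_goals
      filter_upwards [hN.eventually (eventually_one_le_of_tendsto hk),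
        hN.eventually (eventually_ge_atTop 4), hT.eventually (eventually_ge_atTop 1),
        hN.eventually (eventually_sqrt_div_le hδ.2 hk hc),
        hN.eventually (hkT.eventually_ge_atTop ((1 / η) ^ 2)),
        hN.eventually ((tendsto_log_div hδ.2 hk).eventually hc),
        hN.eventually (tendsto_log_natCast.eventually_ge_atTop 1)] with a h1 h2 h3 h4 h5 h6 h7
      have hN4 : (4 : ℝ) ≤ a.1 := by exact_mod_cast h2
      have hN0 : (0 : ℝ) < a.1 := by linarith
      have hT0 : (0 : ℝ) < a.2 := by exact_mod_cast h3
      have hk0 : (0 : ℝ) < k a.1 := by exact_mod_cast h1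
      have hM0 : 0 < M := by linarith
      have hc0 := (Real.exp_pos _).trans_le h6
      unfold relNoise
    · positivity
    · have h8 : 1 / η ≤ √(k a.1 : ℝ) := Real.le_sqrt_of_sq_le h5
      have h9 : 1 ≤ η * √(k a.1 : ℝ) := by
        rwa [div_le_iff₀ hη, mul_comm] at h8
      -- `4 N ≤ N² η √k` because `N ≥ 4` and `η √k ≥ 1`.
      have h10 : Real.log (4 / (η * √(k a.1 : ℝ) / a.1)) ≤ 2 * Real.log a.1 := by
        rw [← Real.log_rpow hN0]
        refine Real.log_le_log (by positivity) ?_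
        rw [div_div_eq_mul_div, div_le_iff₀ (by positivity), Real.rpow_two]
        nlinarith [mul_nonneg (mul_nonneg hN0.le hN0.le) (sub_nonneg.2 h9)]
      have h11 : √(2 * Real.log (4 / (η * √(k a.1 : ℝ) / a.1))) ≤ 2 * √(Real.log a.1) := by
        refine Real.sqrt_le_iff.2 ⟨by positivity, ?_⟩
        rw [mul_pow, Real.sq_sqrt (by linarith)]
        linarith
      have h12 : 1 ≤ √(Real.log a.1) := Real.one_le_sqrt.2 h7
      have h13 : M + 4 * M * √(2 * Real.log (4 / (η * √(k a.1 : ℝ) / a.1))) ≤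
          9 * M * √(Real.log a.1) := by
        nlinarith
      calc _ ≤ (Real.exp (1 / 2 + |γ'|) * (a.1 : ℝ) ^ (δ / 2 + (1 - δ) * (-γ'))) *
            (1 / (a.2 : ℝ) ^ p) * (9 * M * √(Real.log a.1)) := by gcongr
        _ = _ := by ring

end Rate

/-! ### Local Lipschitz bound for the tail quantile. -/

/-- Under the von Mises condition the function `w ↦ F⁻¹(1 - w)` is finite near `0` and, on the
window `[e⁻ˣ / 4, 4 e⁻ˣ]`, Lipschitz with constant of order `c x * eˣ`. -/
lemma VonMises.exists_abs_quantile_sub_le {μ : Measure ℝ} {γ γ' : ℝ} (h : VonMises μ γ)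
    (hγ : γ' < γ) :
    ∃ c Q : ℝ → ℝ, ∃ C > 0, (∀ᶠ x in atTop, Real.exp (γ' * x) ≤ c x) ∧
      (∀ᶠ x in atTop, Real.exp x * deriv (tailQuantile μ) (Real.exp x) = c x) ∧
      ∀ᶠ x in atTop, ∀ w ∈ Icc (Real.exp (-x) / 4) (4 * Real.exp (-x)),
        quantile μ (1 - w) = Q w ∧ ∀ w' ∈ Icc (Real.exp (-x) / 4) (4 * Real.exp (-x)),
          |Q w - Q w'| ≤ C * c x * (|w - w'| * Real.exp x) := by
  obtain ⟨A, c, d, hd, hA⟩ := h.exists_logTailQuantile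
  obtain ⟨C, hC, hlip⟩ := exists_abs_sub_le_mul hd
    (hA.mono fun x hx => ⟨hx.2.1, hx.2.2.1, hx.2.2.2.1⟩)
  refine ⟨c, fun w => A (-Real.log w), C * 4, by positivity,
    eventually_exp_mul_le hγ hd (hA.mono fun x hx => ⟨hx.2.2.1, hx.2.2.2.1⟩),
    hA.mono fun x hx => hx.2.2.2.2, ?_⟩
  obtain ⟨x₁, hx₁⟩ := eventually_atTop.1 hA
  -- This fits the factor-`4` window for `w` into the radius-`2` window for `-log w`.
  have hlog4 : Real.log 4 ≤ 2 := by
    rw [show (4 : ℝ) = 2 ^ 2 by norm_num, Real.log_pow]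
    have := Real.log_two_lt_d9
    push_cast
    linarith
  filter_upwards [hlip, eventually_ge_atTop (x₁ + 2)] with x hx hxx
  have hcx := (hx₁ x (by linarith)).2.2.1
  have hex := Real.exp_pos (-x)
  have hmem : ∀ w ∈ Icc (Real.exp (-x) / 4) (4 * Real.exp (-x)),
      0 < w ∧ -Real.log w ∈ Icc (x - 2) (x + 2) := fun w hw => by
    have hw0 : 0 < w := lt_of_lt_of_le (by positivity) hw.1
    have h1 := Real.log_le_log (by positivity) hw.1
    have h2 := Real.log_le_log hw0 hw.2
    rw [Real.log_div hex.ne' (by norm_num), Real.log_exp] at h1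
    rw [Real.log_mul (by norm_num) hex.ne', Real.log_exp] at h2
    exact ⟨hw0, by linarith, by linarith⟩
  have hlogsub : ∀ w ∈ Icc (Real.exp (-x) / 4) (4 * Real.exp (-x)),
      ∀ w' ∈ Icc (Real.exp (-x) / 4) (4 * Real.exp (-x)),
      Real.log w - Real.log w' ≤ 4 * (|w - w'| * Real.exp x) := fun w hw w' hw' => by
    have h1 := (hmem w hw).1
    have h2 := (hmem w' hw').1
    rw [← Real.log_div h1.ne' h2.ne']
    -- `log s ≤ s - 1` with `s = w / w'`; the lower end `w' ≥ e⁻ˣ / 4` produces the factor `4`.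
    refine (Real.log_le_sub_one_of_pos (by positivity)).trans ?_
    rw [div_sub_one h2.ne']
    calc (w - w') / w' ≤ |w - w'| / w' := by gcongr; exact le_abs_self _
      _ ≤ |w - w'| / (Real.exp (-x) / 4) := by gcongr; exact hw'.1
      _ = 4 * (|w - w'| * Real.exp x) := by
        rw [Real.exp_neg]
        field_simp
  intro w hw
  obtain ⟨hw0, hwx⟩ := hmem w hw
  refine ⟨?_, fun w' hw' => ?_⟩
  · have := (hx₁ (-Real.log w) (by linarith [hwx.1])).1
    rwa [neg_neg, Real.exp_log hw0] at this
  · refine (hx _ hwx _ (hmem w' hw').2).trans ?_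
    rw [show C * 4 * c x * (|w - w'| * Real.exp x) =
      C * (c x * (4 * (|w - w'| * Real.exp x))) by ring, mul_assoc C]
    refine mul_le_mul_of_nonneg_left (mul_le_mul_of_nonneg_left ?_ hcx.le) hC.le
    refine abs_le.2 ⟨?_, ?_⟩
    · linarith [hlogsub w hw w' hw']
    · have := hlogsub w' hw' w hw
      rw [abs_sub_comm w' w] at this
      linarith

/-! ### Deterministic bounds for a fixed value of the order statistic. -/

section Deterministic

variable {F G : Measure ℝ} {p v u b M q y z : ℝ} {N k T : ℕ}

/-- The bound from above treats all `w` by monotonicity and `M`; the bound from below uses only the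
test point `u`. Finiteness of `y` and `z` avoids `∞ - ∞`. -/
lemma teSup_abs_le (hs : 0 < √(k : ℝ) / scale F N k)
    (hG : ∀ w ≤ 1 / 2, quantile G w ≤ (M : EReal)) (hu : u ∈ Icc (0 : ℝ) (1 / 2))
    (hv : quantile F (1 - v) = (y : EReal)) (huv : quantile F (1 - v - u) = (z : EReal))
    (hb : ((-b : ℝ) : EReal) ≤ quantile G u)
    (hM : √(k : ℝ) / scale F N k * (1 / (T : ℝ) ^ p) * M ≤ q)
    (hq : √(k : ℝ) / scale F N k * (y - z) +
      √(k : ℝ) / scale F N k * (1 / (T : ℝ) ^ p) * b ≤ q) :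
    (teSup F G p (1 / 2) N k T v).abs ≤ ENNReal.ofReal q := by
  have hs' : (0 : EReal) ≤ ((√(k : ℝ) / scale F N k : ℝ) : EReal) := EReal.coe_nonneg.2 hs.le
  have ht' : (0 : EReal) ≤ ((1 / (T : ℝ) ^ p : ℝ) : EReal) := EReal.coe_nonneg.2 (by positivity)
  refine abs_le_ofReal ?_ (iSup₂_le fun w hw => ?_)
  · refine le_iSup₂_of_le u hu ?_
    rw [hv, huv]
    calc ((-q : ℝ) : EReal)
        ≤ ((√(k : ℝ) / scale F N k * (z - y + (1 / (T : ℝ) ^ p) * (-b)) : ℝ) : EReal) := by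
          rw [EReal.coe_le_coe_iff]
          linarith
      _ = ((√(k : ℝ) / scale F N k : ℝ) : EReal) *
          ((z : EReal) - y + ((1 / (T : ℝ) ^ p : ℝ) : EReal) * ((-b : ℝ) : EReal)) := by
          norm_cast
      _ ≤ _ := mul_le_mul_of_nonneg_left
          (add_le_add le_rfl (mul_le_mul_of_nonneg_left hb ht')) hs'
  · have h1 : quantile F (1 - v - w) ≤ y := hv ▸ quantile_mono F (by linarith [hw.1])
    rw [hv]
    calc _ ≤ ((√(k : ℝ) / scale F N k : ℝ) : EReal) *
          ((y : EReal) - y + ((1 / (T : ℝ) ^ p : ℝ) : EReal) * ((M : ℝ) : EReal)) :=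
          mul_le_mul_of_nonneg_left (add_le_add (EReal.sub_le_sub h1 le_rfl)
            (mul_le_mul_of_nonneg_left (hG w hw.2) ht')) hs'
      _ = ((√(k : ℝ) / scale F N k * (y - y + (1 / (T : ℝ) ^ p) * M) : ℝ) : EReal) := by
          norm_cast
      _ ≤ q := by
          rw [EReal.coe_le_coe_iff, sub_self, zero_add, ← mul_assoc]
          exact hM

lemma teInf_abs_le (hs : 0 < √(k : ℝ) / scale F N k)
    (hG : ∀ w ≤ 1 / 2, ((-M : ℝ) : EReal) ≤ quantile G (1 - w)) (hu : u ∈ Icc (0 : ℝ) v)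
    (hv2 : v ≤ 1 / 2)
    (hv : quantile F (1 - v) = (y : EReal)) (huv : quantile F (1 - v + u) = (z : EReal))
    (hb : quantile G (1 - u) ≤ (b : EReal))
    (hM : √(k : ℝ) / scale F N k * (1 / (T : ℝ) ^ p) * M ≤ q)
    (hq : √(k : ℝ) / scale F N k * (z - y) +
      √(k : ℝ) / scale F N k * (1 / (T : ℝ) ^ p) * b ≤ q) :
    (teInf F G p N k T v).abs ≤ ENNReal.ofReal q := by
  have hs' : (0 : EReal) ≤ ((√(k : ℝ) / scale F N k : ℝ) : EReal) := EReal.coe_nonneg.2 hs.le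
  have ht' : (0 : EReal) ≤ ((1 / (T : ℝ) ^ p : ℝ) : EReal) := EReal.coe_nonneg.2 (by positivity)
  refine abs_le_ofReal (le_iInf₂ fun w hw => ?_) ?_
  · have h1 : (y : EReal) ≤ quantile F (1 - v + w) := hv ▸ quantile_mono F (by linarith [hw.1])
    rw [hv]
    calc ((-q : ℝ) : EReal)
        ≤ ((√(k : ℝ) / scale F N k * (y - y + (1 / (T : ℝ) ^ p) * (-M)) : ℝ) : EReal) := by
          rw [EReal.coe_le_coe_iff]
          linarith
      _ = ((√(k : ℝ) / scale F N k : ℝ) : EReal) *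
          ((y : EReal) - y + ((1 / (T : ℝ) ^ p : ℝ) : EReal) * ((-M : ℝ) : EReal)) := by
          norm_cast
      _ ≤ _ := mul_le_mul_of_nonneg_left (add_le_add (EReal.sub_le_sub h1 le_rfl)
            (mul_le_mul_of_nonneg_left (hG w (hw.2.trans hv2)) ht')) hs'
  · refine iInf₂_le_of_le u hu ?_
    rw [hv, huv]
    calc _ ≤ ((√(k : ℝ) / scale F N k : ℝ) : EReal) *
          ((z : EReal) - y + ((1 / (T : ℝ) ^ p : ℝ) : EReal) * ((b : ℝ) : EReal)) :=
          mul_le_mul_of_nonneg_left (add_le_add le_rfl (mul_le_mul_of_nonneg_left hb ht')) hs'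
      _ = ((√(k : ℝ) / scale F N k * (z - y + (1 / (T : ℝ) ^ p) * b) : ℝ) : EReal) := by
          norm_cast
      _ ≤ q := by
          rw [EReal.coe_le_coe_iff]
          linarith

end Deterministic

/-- If the order statistic `U_{k,N}` is of order `k / N`, the tail equivalence quantities are
small. -/
lemma eventually_te_abs_le {F : Measure ℝ} {G : ℕ → Measure ℝ} {k : ℕ → ℕ} {δ p M C : ℝ}
    {c Q : ℝ → ℝ} {L : Filter (ℕ × ℕ)} (hδ : δ ∈ Ioo (0 : ℝ) 1)
    (hk : Tendsto (fun N : ℕ => (k N : ℝ) / (N : ℝ) ^ δ) atTop (𝓝 1))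
    (hN : Tendsto Prod.fst L atTop) (hT : Tendsto Prod.snd L atTop) (hM : 1 ≤ M)
    (hGprob : ∀ T ≥ 1, IsProbabilityMeasure (G T))
    (hG : ∀ T ≥ 1, (G T).real {x | M < |x|} < 1 / 2) (hC : 0 < C)
    (hc : ∀ᶠ x in atTop, 0 < c x)
    (hscale : ∀ᶠ x in atTop, Real.exp x * deriv (tailQuantile F) (Real.exp x) = c x)
    (hQ : ∀ᶠ x in atTop, ∀ w ∈ Icc (Real.exp (-x) / 4) (4 * Real.exp (-x)),
      quantile F (1 - w) = Q w ∧ ∀ w' ∈ Icc (Real.exp (-x) / 4) (4 * Real.exp (-x)),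
        |Q w - Q w'| ≤ C * c x * (|w - w'| * Real.exp x))
    (hb : ∀ η > 0, ∃ b : ℕ × ℕ → ℝ, (∀ᶠ a in L, 1 ≤ b a) ∧
      (∀ᶠ a in L, (G a.2).real {x | b a < |x|} < η * √(k a.1) / a.1) ∧
      Tendsto (fun a => relNoise c k p a * b a) L (𝓝 0)) {q : ℝ} (hq : 0 < q) :
    ∀ᶠ a in L, ∀ v ∈ Icc ((k a.1 : ℝ) / (2 * a.1)) (2 * k a.1 / a.1),
      (teSup F (G a.2) p (1 / 2) a.1 (k a.1) a.2 v).abs ≤ ENNReal.ofReal q ∧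
      (teInf F (G a.2) p a.1 (k a.1) a.2 v).abs ≤ ENNReal.ofReal q := by
  -- The scaled increment of `F⁻¹` at `u = η √k / N` is at most `C η = q / 2`, leaving `q / 2` for
  -- the noise.
  set η := q / (2 * C) with hη
  have hη0 : 0 < η := by positivity
  obtain ⟨b, hb1, hbG, hblim⟩ := hb η hη0
  have hxlim := tendsto_log_div hδ.2 hk
  have hkT := tendsto_natCast_of_tendsto_div hδ.1 hk
  filter_upwards [hb1, hbG, hblim.eventually_lt_const (show (0 : ℝ) < q / 2 by positivity),
    hblim.eventually_lt_const (show (0 : ℝ) < q / M by positivity),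
    hN.eventually (hxlim.eventually hc), hN.eventually (hxlim.eventually hscale),
    hN.eventually (hxlim.eventually hQ), hN.eventually (eventually_one_le_of_tendsto hk),
    hN.eventually (hkT.eventually_ge_atTop ((4 * η) ^ 2)),
    hN.eventually (hxlim.eventually_ge_atTop (Real.log 4)),
    hN.eventually (eventually_ge_atTop 1),
    hT.eventually (eventually_ge_atTop 1)] with a h1 h2 h3 h4 h5 h6 h7 h8 h9 h10 h11 h12 v hv
  have := hGprob a.2 h12
  have hN0 : (0 : ℝ) < a.1 := by exact_mod_cast h11
  have hk0 : (0 : ℝ) < k a.1 := by exact_mod_cast h8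
  have hT0 : (0 : ℝ) < a.2 := by exact_mod_cast h12
  set n : ℝ := (a.1 : ℝ) with hn
  set κ : ℝ := (k a.1 : ℝ) with hκ
  have hexp : Real.exp (Real.log (n / κ)) = n / κ := Real.exp_log (by positivity)
  have hexpn : Real.exp (-Real.log (n / κ)) = κ / n := by
    rw [Real.exp_neg, hexp, inv_div]
  rw [hexp] at h6 h7
  rw [hexpn] at h7
  have hsc : scale F a.1 (k a.1) = c (Real.log (n / κ)) := h6
  set cx := c (Real.log (n / κ)) with hcx
  have hsqrt : 0 < √κ := Real.sqrt_pos.2 hk0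
  have hss : √κ * √κ = κ := Real.mul_self_sqrt hk0.le
  have h4k : 4 * κ ≤ n := by
    rwa [Real.log_le_log_iff (by norm_num) (by positivity), le_div_iff₀ hk0] at h10
  have h4η : 4 * η ≤ √κ := Real.le_sqrt_of_sq_le h9
  set u := η * √κ / n with hu
  have hu0 : 0 ≤ u := by positivity
  -- Thus `v ± u` stays in `[m / 4, 4 m]` when `v ∈ [m / 2, 2 m]`, where `m = k / N`.
  have hu4 : u ≤ κ / n / 4 := by
    rw [hu, div_div, div_le_div_iff₀ hN0 (by positivity)]
    nlinarith [mul_le_mul_of_nonneg_left (mul_le_mul_of_nonneg_right h4η hsqrt.le) hN0.le]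
  have e1 : κ / (2 * n) = κ / n / 2 := by rw [div_div, mul_comm]
  have e2 : 2 * κ / n = 2 * (κ / n) := by rw [mul_div_assoc]
  rw [e1, e2] at hv
  set m := κ / n with hm
  have hm0 : 0 < m := by positivity
  -- Ensures `v ≤ 2 m ≤ 1 / 2`, the range where `M` bounds the noise quantiles in the infimum.
  have hm4 : m ≤ 1 / 4 := by
    rw [hm, div_le_iff₀ hN0]
    linarith
  have hs : 0 < √(k a.1 : ℝ) / scale F a.1 (k a.1) := by
    rw [hsc]
    exact div_pos hsqrt h5
  have hwv : v ∈ Icc (m / 4) (4 * m) := ⟨by linarith [hv.1], by linarith [hv.2]⟩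
  have hwa : v + u ∈ Icc (m / 4) (4 * m) := ⟨by linarith [hv.1], by linarith [hv.2]⟩
  have hws : v - u ∈ Icc (m / 4) (4 * m) := ⟨by linarith [hv.1], by linarith [hv.2]⟩
  have hrel : √(k a.1 : ℝ) / scale F a.1 (k a.1) * (1 / (a.2 : ℝ) ^ p) = relNoise c k p a := by
    rw [hsc, relNoise]
  have hrel0 : 0 ≤ relNoise c k p a := by
    rw [← hrel]
    positivity
  have hlip : ∀ D, D ≤ C * cx * (u * (n / κ)) →
      √(k a.1 : ℝ) / scale F a.1 (k a.1) * D ≤ q / 2 := fun D hD => by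
    refine (mul_le_mul_of_nonneg_left hD hs.le).trans (le_of_eq ?_)
    rw [hsc, hu, hη, ← hκ]
    calc √κ / cx * (C * cx * (q / (2 * C) * √κ / n * (n / κ)))
        = (√κ * √κ) / κ * (q / 2) := by
          field_simp
      _ = q / 2 := by rw [hss, div_self hk0.ne', one_mul]
  have hMq : √(k a.1 : ℝ) / scale F a.1 (k a.1) * (1 / (a.2 : ℝ) ^ p) * M ≤ q := by
    rw [hrel]
    rw [lt_div_iff₀ (by linarith)] at h4
    nlinarith
  have hGT := hG a.2 h12
  have hG1 := neg_le_quantile_of_measure_abs_lt hGT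
  have hG2 := quantile_one_sub_le_of_measure_abs_lt hGT
  constructor
  · refine teSup_abs_le (u := u) (b := b a) (M := M) (y := Q v) (z := Q (v + u)) hs
      (fun w hw => (quantile_mono _ (by linarith)).trans hG2) ⟨hu0, by linarith⟩ (h7 v hwv).1
      (by rw [sub_sub]; exact (h7 _ hwa).1) (neg_le_quantile_of_measure_abs_lt h2) hMq ?_
    rw [hrel]
    have h13 := (h7 v hwv).2 _ hwa
    rw [sub_add_cancel_left, abs_neg, abs_of_nonneg hu0] at h13
    linarith [hlip _ ((le_abs_self _).trans h13)]
  · refine teInf_abs_le (u := u) (b := b a) (M := M) (y := Q v) (z := Q (v - u)) hs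
      (fun w hw => hG1.trans (quantile_mono _ (by linarith))) ⟨hu0, by linarith [hv.1]⟩
      (by linarith [hv.2]) (h7 v hwv).1
      (by rw [show 1 - v + u = 1 - (v - u) by ring]; exact (h7 _ hws).1)
      (quantile_one_sub_le_of_measure_abs_lt h2) hMq ?_
    rw [hrel]
    have h13 := (h7 _ hws).2 _ hwv
    rw [sub_sub_cancel_left, abs_neg, abs_of_nonneg hu0] at h13
    linarith [hlip _ ((le_abs_self _).trans h13)]

/-- One family of bad events serves every threshold; `q = η / 2` is used since the events in the
definition are `η ≤ |X|`, not strict. -/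
lemma tendstoInProbZero_of_eventually {α Ω : Type*} [MeasurableSpace Ω] {P : Measure Ω}
    {X : α → Ω → EReal} {L : Filter α} {B : α → Set Ω} (hB : Tendsto (fun a => P (B a)) L (𝓝 0))
    (hX : ∀ q > 0, ∀ᶠ a in L, ∀ ω ∉ B a, (X a ω).abs ≤ ENNReal.ofReal q) :
    TendstoInProbZero P X L := fun η hη => by
  refine tendsto_of_tendsto_of_tendsto_of_le_of_le' tendsto_const_nhds hB
    (Eventually.of_forall fun _ => zero_le) ?_
  filter_upwards [hX (η / 2) (half_pos hη)] with a ha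
  refine measure_mono fun ω hω => ?_
  by_contra hcon
  have h1 := (show ENNReal.ofReal η ≤ _ from hω).trans (ha ω hcon)
  rw [ENNReal.ofReal_le_ofReal_iff (by positivity)] at h1
  linarith

end NoisyEVT

open NoisyEVT in
theorem proposition2
    {Ω Ω' : Type*} [MeasurableSpace Ω] [MeasurableSpace Ω']
    (P : Measure Ω) [IsProbabilityMeasure P] (P' : Measure Ω') [IsProbabilityMeasure P']
    -- latent `θ i`, scaled estimation noise `ε T i` for unit `i` and sample size `T ≥ 1`
    (θ : ℕ → Ω → ℝ) (ε : ℕ → ℕ → Ω → ℝ)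
    -- for each `T` the pairs `(θ i, ε T i)` are iid over `i`
    (h_indep : ∀ T ≥ 1, iIndepFun (fun i ω => (θ i ω, ε T i ω)) P)
    (h_ident : ∀ T ≥ 1, ∀ i, IdentDistrib
      (fun ω => (θ i ω, ε T i ω)) (fun ω => (θ 0 ω, ε T 0 ω)) P P)
    -- the laws of the noise form a tight family
    (h_tight : IsTightMeasureSet ((fun T => P.map (ε T 0)) '' Ici 1))
    -- the iid uniform variables appearing in the tail equivalence conditions
    (U : ℕ → Ω' → ℝ) (hU_indep : iIndepFun U P')
    (hU_unif : ∀ i, pdf.IsUniform (U i) (Icc (0 : ℝ) 1) P' volume)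
    (p : ℝ) (hp : 0 < p) (δ : ℝ) (hδ : δ ∈ Ioo (0 : ℝ) 1)
    -- `k = N ^ δ`, up to rounding to an integer
    (k : ℕ → ℕ) (hk : Tendsto (fun N : ℕ => (k N : ℝ) / (N : ℝ) ^ δ) atTop (𝓝 1))
    -- the mode of joint divergence of `(N, T)`
    (L : Filter (ℕ × ℕ)) (hN : Tendsto Prod.fst L atTop) (hT : Tendsto Prod.snd L atTop)
    (γ γ' : ℝ) (hγ : γ' < γ)
    (h_rate :
      (∃ β > 0, (⨆ T ∈ Ici (1 : ℕ), ∫⁻ ω, ‖ε T 0 ω‖ₑ ^ β ∂P) < ∞ ∧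
        ∃ ν > 0, Tendsto (fun a : ℕ × ℕ =>
          (a.1 : ℝ) ^ (δ / 2 * (1 + 1 / β) + (1 - δ) * (-γ' + 1 / β) + ν / β) / (a.2 : ℝ) ^ p)
          L (𝓝 0))
      ∨
      ((∀ T ≥ 1, ∃ (m : ℝ) (σsq : ℝ≥0), P.map (ε T 0) = gaussianReal m σsq) ∧
        Tendsto (fun a : ℕ × ℕ =>
          (a.1 : ℝ) ^ (δ / 2 + (1 - δ) * (-γ')) * √(Real.log a.1) / (a.2 : ℝ) ^ p) L (𝓝 0)))
    (hF : NoisyEVT.VonMises (P.map (θ 0)) γ) :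
    NoisyEVT.IntermediateTESup P' U (P.map (θ 0)) (fun T => P.map (ε T 0)) p k L ∧
    NoisyEVT.IntermediateTEInf P' U (P.map (θ 0)) (fun T => P.map (ε T 0)) p k L := by
  have hεm : ∀ T ≥ 1, AEMeasurable (ε T 0) P := fun T hT1 =>
    measurable_snd.comp_aemeasurable (h_ident T hT1 0).aemeasurable_fst
  have hGprob : ∀ T ≥ 1, IsProbabilityMeasure (P.map (ε T 0)) := fun T hT1 =>
    Measure.isProbabilityMeasure_map (hεm T hT1)
  obtain ⟨M, hM, hMG⟩ := exists_measure_abs_lt_half (μ := fun T => P.map (ε T 0)) h_tight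
  obtain ⟨c, Q, C, hC, hcexp, hscale, hQ⟩ := hF.exists_abs_quantile_sub_le hγ
  have hb : ∀ η > 0, ∃ b : ℕ × ℕ → ℝ, (∀ᶠ a in L, 1 ≤ b a) ∧
      (∀ᶠ a in L, (P.map (ε a.2 0)).real {x | b a < |x|} < η * √(k a.1) / a.1) ∧
      Tendsto (fun a => relNoise c k p a * b a) L (𝓝 0) := by
    intro η hη
    rcases h_rate with ⟨β, hβ, hfin, ν, hν, hlim⟩ | ⟨hgauss, hlim⟩
    · refine relNoise_bound_moment (μ := fun T => P.map (ε T 0))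
        (C := (⨆ T ∈ Ici (1 : ℕ), ∫⁻ ω, ‖ε T 0 ω‖ₑ ^ β ∂P).toReal) hβ ENNReal.toReal_nonneg hν hδ hk
        hcexp hN hT (fun T hT1 => ?_) hlim hη
      rw [ENNReal.ofReal_toReal hfin.ne, lintegral_map' (by fun_prop) (hεm T hT1)]
      exact le_iSup₂ (f := fun T (_ : T ∈ Ici (1 : ℕ)) => ∫⁻ ω, ‖ε T 0 ω‖ₑ ^ β ∂P) T hT1
    · exact relNoise_bound_gaussian (μ := fun T => P.map (ε T 0)) hM hδ hk hcexp hN hT hMG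
        hgauss hlim hη
  have hmain := fun q (hq : (0 : ℝ) < q) => eventually_te_abs_le (G := fun T => P.map (ε T 0)) hδ hk
    hN hT hM hGprob hMG hC (hcexp.mono fun x hx => (Real.exp_pos _).trans_le hx) hscale hQ hb hq
  have hbad : Tendsto (fun a : ℕ × ℕ => P' {ω | orderStat a.1 (k a.1) (fun i => U i ω) ∉
      Icc ((k a.1 : ℝ) / (2 * a.1)) (2 * k a.1 / a.1)}) L (𝓝 0) := by
    have hlim : Tendsto (fun a : ℕ × ℕ => ENNReal.ofReal (4 / (k a.1 : ℝ))) L (𝓝 0) := by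
      simpa using ENNReal.tendsto_ofReal
        (((tendsto_natCast_of_tendsto_div hδ.1 hk).const_div_atTop 4).comp hN)
    refine tendsto_of_tendsto_of_tendsto_of_le_of_le' tendsto_const_nhds hlim
      (Eventually.of_forall fun _ => zero_le) ?_
    filter_upwards [hN.eventually (eventually_one_le_of_tendsto hk),
      hN.eventually (eventually_two_mul_le hδ.2 hk)] with a h1 h2
    exact measure_orderStat_notMem_le hU_indep hU_unif h1 h2
  -- `ε = 1 / 2` matches the level at which tightness was applied.
  refine ⟨⟨1 / 2, by norm_num, ?_⟩, ?_⟩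
  · exact tendstoInProbZero_of_eventually hbad fun q hq => (hmain q hq).mono fun a ha ω hω =>
      (ha _ (not_not.1 hω)).1
  · exact tendstoInProbZero_of_eventually hbad fun q hq => (hmain q hq).mono fun a ha ω hω =>
      (ha _ (not_not.1 hω)).2
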